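/- All graphs are finite and simple. Given a graph $H$ and vertex-disjoint graphs $G_1,\dots,G_q$ ($q\ge 0$), a graph $G$ is obtained from $H$ by *gluing on* $G_1,\dots,G_q$ if there is an injection $f:\bigcup_i V(G_i)\to V(H)$ (not necessarily surjective) such that $V(G)=V(H)$ and $E(G)=E(H)\cup\bigcup_i\{f(a)f(b): ab\in E(G_i)\}$. A path has length equal to its number of edges; a single vertex is a path of length $0$. Let $H$ be a disjoint union of triangles and paths (that is, every connected component of $H$ is a triangle or a path), and let $G$ be obtained from $H$ by gluing on vertex-disjoint triangles. Two distinct triangle components $T,T'$ of $H$ are *path-linked* in $G$ if some glued-in triangle $Y$ has one vertex in $T$, one vertex in $T'$, and its third vertex in a component of $H$ that is a path of length at least $2$. **Conjecture 1.** Let $H$ be a graph which is a disjoint union of triangles and paths of length at most $12$, and let $G$ be obtained from $H$ by gluing on vertex-disjoint triangles. Suppose that every triangle component of $H$ is path-linked in $G$ to at most one other triangle component of $H$. Then $G$ is $3$-colourable. **Conjecture 2.** Let $H$ be a graph with maximum degree $\Delta(H)\le 2$, and let $G$ be obtained from $H$ by gluing on vertex-disjoint copies of $K_4$. Then $\chi(G)\le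 4$. **Theorem.** If Conjecture 1 is true, then Conjecture 2 is true. -/

import Mathlib

universe u v w

namespace CyclesPlusK4

/-- The graph obtained from `H` by gluing on the vertex-disjoint graphs `K i` along an injection
`f` of the disjoint union of their vertex sets into the vertex set of `H`: the vertices are those of
`H`, and the edges are those of `H` together with the images of the edges of all the `K i`. -/
def glue {V : Type u} {ι : Type v} {W : ι → Type w} (H : SimpleGraph V)
    (K : ∀ i, SimpleGraph (W i)) (f : (Σ i, W i) ↪ V) : SimpleGraph V :=
  H ⊔ ⨆ i, (K i).map ((Function.Embedding.sigmaMk i).trans f)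

theorem glue_adj {V : Type u} {ι : Type v} {W : ι → Type w} (H : SimpleGraph V)
    (K : ∀ i, SimpleGraph (W i)) (f : (Σ i, W i) ↪ V) (x y : V) :
    (glue H K f).Adj x y ↔
      H.Adj x y ∨ ∃ i, ∃ a b : W i, (K i).Adj a b ∧ f ⟨i, a⟩ = x ∧ f ⟨i, b⟩ = y := by
  simp [glue, SimpleGraph.map_adj]

/-- The graph obtained from `H` by gluing on `q` vertex-disjoint copies of the complete graph on
`k` vertices. The vertices of the `i`-th glued-in copy are `f ⟨i, a⟩` for `a : Fin k`. -/
def glueComplete {V : Type u} (H : SimpleGraph V) {q k : ℕ} (f : (Σ _ : Fin q, Fin k) ↪ V) :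
    SimpleGraph V :=
  glue H (fun _ : Fin q => SimpleGraph.completeGraph (Fin k)) f

/-- The connected component `C` of `H` is a triangle. -/
def IsTriangle {V : Type u} {H : SimpleGraph V} (C : H.ConnectedComponent) : Prop :=
  Nonempty (C.toSimpleGraph ≃g SimpleGraph.completeGraph (Fin 3))

/-- The connected component `C` of `H` is a path of length `n`, that is, a path with `n` edges and
`n + 1` vertices. -/
def IsPathOfLength {V : Type u} {H : SimpleGraph V} (C : H.ConnectedComponent) (n : ℕ) : Prop :=
  Nonempty (C.toSimpleGraph ≃g SimpleGraph.pathGraph (n + 1))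

/-- `H` is a disjoint union of triangles and paths of length at most `m`. -/
def IsUnionOfTrianglesAndPaths {V : Type u} (H : SimpleGraph V) (m : ℕ) : Prop :=
  ∀ C : H.ConnectedComponent, IsTriangle C ∨ ∃ n ≤ m, IsPathOfLength C n

/-- After gluing triangles onto `H` along `f`, the triangle components `T` and `T'` of `H` are
path-linked: some glued-in triangle meets both `T` and `T'`, and its third vertex lies on a path
component of `H` of length at least two. -/
def PathLinked {V : Type u} {H : SimpleGraph V} {q : ℕ} (f : (Σ _ : Fin q, Fin 3) ↪ V)
    (T T' : H.ConnectedComponent) : Prop :=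
  IsTriangle T ∧ IsTriangle T' ∧
    ∃ i : Fin q, ∃ a b c : Fin 3, a ≠ b ∧ a ≠ c ∧ b ≠ c ∧
      f ⟨i, a⟩ ∈ T.supp ∧ f ⟨i, b⟩ ∈ T'.supp ∧
      ∃ n, 2 ≤ n ∧ IsPathOfLength (H.connectedComponentMk (f ⟨i, c⟩)) n

/-- The conjecture on gluing triangles onto a disjoint union of triangles and paths of length at
most 12, for finite graphs. -/
def TrianglesConjecture : Prop :=
  ∀ (V : Type u) [Finite V] (H : SimpleGraph V) (q : ℕ) (f : (Σ _ : Fin q, Fin 3) ↪ V),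
    IsUnionOfTrianglesAndPaths H 12 →
    (∀ T T₁ T₂ : H.ConnectedComponent, T₁ ≠ T → T₂ ≠ T →
      PathLinked f T T₁ → PathLinked f T T₂ → T₁ = T₂) →
    (glueComplete H f).Colorable 3

/-- The "cycles plus `K₄`'s" conjecture, for finite graphs. -/
def CyclesPlusK4Conjecture : Prop :=
  ∀ (V : Type u) [Fintype V] (H : SimpleGraph V) [DecidableRel H.Adj] (q : ℕ)
    (f : (Σ _ : Fin q, Fin 4) ↪ V),
    H.maxDegree ≤ 2 → (glueComplete H f).chromaticNumber ≤ 4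

end CyclesPlusK4

/-! It suffices to find an `H`-independent set `S` meeting each glued-in `K₄` exactly once, such
that `H - S` with the remaining triangles satisfies the hypotheses of `TrianglesConjecture`: three
colours then serve outside `S` and a fourth on `S`.

To leave only short paths, `S` must hit long components often. Non-triangle components with at least
four vertices contain disjoint blocks `D`, spaced so that hitting all of them leaves pieces of at
most 13 vertices; each block has an interior `I` of at least four vertices whose neighbours stay in
`D`. A triangle is a single block (`AtMostTwoNeighbors.exists_blocks`). Call the vertex sets of the
`K₄`'s, and the single remaining vertices, classes. They have at most four vertices, so Hall's
condition for matching blocks to classes can fail only because triangles have three.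
`exists_matching_linkedTo_le_one` leaves out a set `U` of triangles, as small as possible and then
with as few links as possible; exchange along a Hall circuit shows that each is linked to at most
one other. All other blocks get representatives `Q` in distinct classes.

Haxell's theorem gives an independent transversal of the `K₄`'s, since 4 is twice the maximum
degree. Among such sets, one sharing the most vertices with `Q` hits every block outside `U`
(`exists_independent_transversal_hitting`). So only triangles of `H` in `U` can survive the deletion
of `S`, and path-links between them are links in `U`. -/

namespace CyclesPlusK4

/-! ### Independent transversals: Haxell's theorem -/

/-- `f` is an independent system of representatives in `H` of the sets `P i`, `i ∈ A`. -/
def IsISR {V : Type u} {ι : Type v} (H : SimpleGraph V) (A : Finset ι) (P : ι → Finset V)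
    (f : ι → V) : Prop :=
  (∀ i ∈ A, f i ∈ P i) ∧ ∀ i ∈ A, ∀ j ∈ A, ¬ H.Adj (f i) (f j)

/-- Every vertex of `H` has at most two neighbours. -/
def AtMostTwoNeighbors {V : Type u} (H : SimpleGraph V) : Prop :=
  ∀ x a b c, H.Adj x a → H.Adj x b → H.Adj x c → a = b ∨ a = c ∨ b = c

open Classical in
/-- **Haxell's lemma**: if the sets `P i`, `i ∈ A`, have no independent system of representatives,
but those with `i ≠ r` do, then for some `J ∋ r` the union of the `P i`, `i ∈ J`, is totally
dominated by at most `2 (|J| - 1)` vertices. -/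
theorem exists_dominating_of_not_isISR {V : Type u} {ι : Type v} [Finite V] (N : ℕ) :
    ∀ (H : SimpleGraph V) (A : Finset ι) (P : ι → Finset V) (r : ι), r ∈ A →
      A.card + H.edgeSet.ncard ≤ N →
      (∀ i ∈ A, ∀ j ∈ A, ∀ x, x ∈ P i → x ∈ P j → i = j) →
      (∃ f, IsISR H (A.erase r) P f) → (¬ ∃ f, IsISR H A P f) →
      ∃ J ⊆ A, r ∈ J ∧ ∃ Z : Finset V, Z.card ≤ 2 * (J.card - 1) ∧
        ∀ i ∈ J, ∀ x ∈ P i, ∃ z ∈ Z, H.Adj z x := by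
  induction N with
  | zero =>
    intro H A P r hr hN
    have := Finset.card_pos.2 ⟨r, hr⟩
    omega
  | succ N ih =>
    rintro H A P r hr hN hP ⟨f, hf⟩ hno
    rcases (P r).eq_empty_or_nonempty with hemp | ⟨w, hw⟩
    · refine ⟨{r}, by simpa using hr, by simp, ∅, by simp, ?_⟩
      intro i hi x hx
      simp only [Finset.mem_singleton] at hi
      simp [hi, hemp] at hx
    -- Otherwise `w` would extend `f` to a full system.
    obtain ⟨i₀, hi₀, hadj⟩ : ∃ i ∈ A.erase r, H.Adj w (f i) := by
      by_contra! hcon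
      refine hno ⟨Function.update f r w, ?_, ?_⟩
      · intro i hi
        by_cases h : i = r
        · subst h; simpa using hw
        · simpa [h] using hf.1 i (by simp [h, hi])
      · intro i hi j hj
        by_cases h : i = r <;> by_cases h' : j = r
        · simp [h, h']
        · subst h; simpa [h'] using hcon j (by simp [h', hj])
        · subst h'; simpa [h, SimpleGraph.adj_comm] using hcon i (by simp [h, hi])
        · simpa [h, h'] using hf.2 i (by simp [h, hi]) j (by simp [h', hj])
    have hi₀A : i₀ ∈ A := Finset.mem_of_mem_erase hi₀
    have hi₀r : i₀ ≠ r := Finset.ne_of_mem_erase hi₀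
    have hm : f i₀ ∈ P i₀ := hf.1 i₀ hi₀
    set m := f i₀ with hmdef
    -- If `H₁` still has no system, the induction is on edges, and domination in `H₁` is domination
    -- in `H`. Otherwise a system `g` of `H₁` must use both ends of the deleted edge, since it fails
    -- in `H`.
    set H₁ := H.deleteEdges {s(w, m)} with hH₁
    have hle : H₁ ≤ H := SimpleGraph.deleteEdges_le _
    have hH₁adj : ∀ x y, H.Adj x y → ¬ H₁.Adj x y → (x = w ∧ y = m) ∨ (x = m ∧ y = w) := by
      intro x y h1 h2
      have h3 : ¬ (x = w ∧ y = m) → x = m ∧ y = w := by simpa [hH₁, h1] using h2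
      tauto
    by_cases hno₁ : ∃ g, IsISR H₁ A P g
    · obtain ⟨g, hg⟩ := hno₁
      have hidw : ∀ i ∈ A, g i = w → i = r := fun i hi h => hP i hi r hr w (h ▸ hg.1 i hi) hw
      have hidm : ∀ i ∈ A, g i = m → i = i₀ := fun i hi h =>
        hP i hi i₀ hi₀A m (h ▸ hg.1 i hi) hm
      have hgH : ∀ i ∈ A, ∀ j ∈ A, H.Adj (g i) (g j) →
          (g i = w ∧ g j = m) ∨ (g i = m ∧ g j = w) := fun i hi j hj h =>
        hH₁adj _ _ h (hg.2 i hi j hj)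
      have hgrm : g r = w ∧ g i₀ = m := by
        by_contra hcon
        refine hno ⟨g, hg.1, fun i hi j hj h => hcon ?_⟩
        rcases hgH i hi j hj h with ⟨h1, h2⟩ | ⟨h1, h2⟩
        · rw [← hidw i hi h1, ← hidm j hj h2]; exact ⟨h1, h2⟩
        · rw [← hidw j hj h2, ← hidm i hi h1]; exact ⟨h2, h1⟩
      have hgw : ∀ i ∈ A, i ≠ i₀ → ¬ H.Adj w (g i) := by
        intro i hi hne h
        rw [← hgrm.1] at h
        rcases hgH r hr i hi h with ⟨_, h2⟩ | ⟨h1, _⟩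
        · exact hne (hidm i hi h2)
        · exact hi₀r (hidm r hr h1).symm
      have hgm : ∀ i ∈ A, i ≠ r → ¬ H.Adj m (g i) := by
        intro i hi hne h
        rw [← hgrm.2] at h
        rcases hgH i₀ hi₀A i hi h with ⟨h1, _⟩ | ⟨_, h2⟩
        · exact hi₀r (hidw i₀ hi₀A h1)
        · exact hne (hidw i hi h2)
      -- Merge `P r` with `P i₀` and discard what `w` or `m` dominates. A system for `P'` would
      -- yield one for `P`: its value at `r` lies in `P r` or `P i₀`, and `m` or `w` respectively
      -- represents the other set. Restoring `i₀` later allows two more dominating vertices, namely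
      -- `w` and `m`.
      let P' : ι → Finset V := fun i =>
        (if i = r then P r ∪ P i₀ else P i).filter fun x => ¬ H.Adj w x ∧ ¬ H.Adj m x
      have hP'r : ∀ x, x ∈ P' r ↔ (x ∈ P r ∨ x ∈ P i₀) ∧ ¬ H.Adj w x ∧ ¬ H.Adj m x := by
        intro x; simp [P']
      have hP'n : ∀ i, i ≠ r → ∀ x, x ∈ P' i ↔ x ∈ P i ∧ ¬ H.Adj w x ∧ ¬ H.Adj m x := by
        intro i hi x; simp [P', hi]
      have hrA' : r ∈ A.erase i₀ := by simp [hr, hi₀r.symm]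
      have hcard := Finset.card_erase_of_mem hi₀A
      have hpos := Finset.card_pos.2 ⟨r, hr⟩
      obtain ⟨J, hJA, hrJ, Z, hZ, hdom⟩ := ih H (A.erase i₀) P' r hrA' (by omega) (by
          intro i hi j hj x hxi hxj
          simp only [Finset.mem_erase] at hi hj
          by_cases h : i = r <;> by_cases h' : j = r
          · rw [h, h']
          · subst h
            rw [hP'r] at hxi
            rw [hP'n j h'] at hxj
            rcases hxi.1 with h1 | h1
            · exact hP _ hr _ hj.2 x h1 hxj.1
            · exact absurd (hP _ hi₀A _ hj.2 x h1 hxj.1).symm hj.1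
          · subst h'
            rw [hP'r] at hxj
            rw [hP'n i h] at hxi
            rcases hxj.1 with h1 | h1
            · exact hP _ hi.2 _ hr x hxi.1 h1
            · exact absurd (hP _ hi.2 _ hi₀A x hxi.1 h1) hi.1
          · rw [hP'n i h] at hxi
            rw [hP'n j h'] at hxj
            exact hP i hi.2 j hj.2 x hxi.1 hxj.1)
        (by
          refine ⟨g, ?_, ?_⟩
          · intro i hi
            simp only [Finset.mem_erase] at hi
            rw [hP'n i hi.1]
            exact ⟨hg.1 i hi.2.2, hgw i hi.2.2 hi.2.1, hgm i hi.2.2 hi.1⟩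
          · intro i hi j hj h
            simp only [Finset.mem_erase] at hi hj
            rcases hgH i hi.2.2 j hj.2.2 h with ⟨h1, _⟩ | ⟨_, h1⟩
            · exact hi.1 (hidw i hi.2.2 h1)
            · exact hj.1 (hidw j hj.2.2 h1))
        (by
          rintro ⟨h, hh⟩
          obtain ⟨hr1, hr2, hr3⟩ := (hP'r _).1 (hh.1 r hrA')
          have hother : ∀ i ∈ A, i ≠ r → i ≠ i₀ →
              h i ∈ P i ∧ ¬ H.Adj w (h i) ∧ ¬ H.Adj m (h i) ∧ ¬ H.Adj (h r) (h i) := by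
            intro i hi h1 h2
            have := (hP'n i h1 _).1 (hh.1 i (by simp [hi, h2]))
            exact ⟨this.1, this.2.1, this.2.2, hh.2 r hrA' i (by simp [hi, h2])⟩
          have key : ∀ a b : V, a ∈ P r → b ∈ P i₀ → ¬ H.Adj a b →
              (∀ i ∈ A, i ≠ r → i ≠ i₀ → ¬ H.Adj a (h i) ∧ ¬ H.Adj b (h i)) → False := by
            intro a b ha hb hab hrest
            have hval : ∀ i, i ≠ r → i ≠ i₀ →
                Function.update (Function.update h i₀ b) r a i = h i := by
              intro i h1 h2; simp [h1, h2]
            have hvi : Function.update (Function.update h i₀ b) r a i₀ = b := by simp [hi₀r]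
            have hvr : Function.update (Function.update h i₀ b) r a r = a := by simp
            refine hno ⟨Function.update (Function.update h i₀ b) r a, ?_, ?_⟩
            · intro i hi
              by_cases h1 : i = r
              · subst h1; rw [hvr]; exact ha
              by_cases h2 : i = i₀
              · subst h2; rw [hvi]; exact hb
              rw [hval i h1 h2]; exact (hother i hi h1 h2).1
            · intro i hi j hj
              by_cases h1 : i = r
              · subst h1
                rw [hvr]
                by_cases h3 : j = i
                · subst h3; rw [hvr]; exact H.irrefl
                by_cases h4 : j = i₀
                · subst h4; rw [hvi]; exact hab
                rw [hval j h3 h4]; exact (hrest j hj h3 h4).1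
              by_cases h2 : i = i₀
              · subst h2
                rw [hvi]
                by_cases h3 : j = r
                · subst h3; rw [hvr]; exact fun hc => hab hc.symm
                by_cases h4 : j = i
                · subst h4; rw [hvi]; exact H.irrefl
                rw [hval j h3 h4]; exact (hrest j hj h3 h4).2
              rw [hval i h1 h2]
              by_cases h3 : j = r
              · subst h3; rw [hvr]; exact fun hc => (hrest i hi h1 h2).1 hc.symm
              by_cases h4 : j = i₀
              · subst h4; rw [hvi]; exact fun hc => (hrest i hi h1 h2).2 hc.symm
              rw [hval j h3 h4]
              exact hh.2 i (by simp [hi, h2]) j (by simp [hj, h4])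
          rcases hr1 with h1 | h1
          · exact key (h r) m h1 hm (fun hc => hr3 hc.symm) fun i hi h2 h3 =>
              ⟨(hother i hi h2 h3).2.2.2, (hother i hi h2 h3).2.2.1⟩
          · exact key w (h r) hw h1 hr2 fun i hi h2 h3 =>
              ⟨(hother i hi h2 h3).2.1, (hother i hi h2 h3).2.2.2⟩)
      have hi₀J : i₀ ∉ J := fun h => by simpa using hJA h
      refine ⟨insert i₀ J, ?_, Finset.mem_insert_of_mem hrJ, insert w (insert m Z), ?_, ?_⟩
      · intro i hi
        rcases Finset.mem_insert.1 hi with rfl | hi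
        · exact hi₀A
        · exact Finset.mem_of_mem_erase (hJA hi)
      · have h1 := Finset.card_insert_le w (insert m Z)
        have h2 := Finset.card_insert_le m Z
        have h3 := Finset.card_pos.2 ⟨r, hrJ⟩
        rw [Finset.card_insert_of_notMem hi₀J]
        omega
      · intro i hi x hx
        by_cases h1 : H.Adj w x
        · exact ⟨w, by simp, h1⟩
        by_cases h2 : H.Adj m x
        · exact ⟨m, by simp, h2⟩
        have : ∃ i' ∈ J, x ∈ P' i' := by
          by_cases h3 : i = r
          · subst h3
            exact ⟨i, hrJ, (hP'r x).2 ⟨Or.inl hx, h1, h2⟩⟩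
          rcases Finset.mem_insert.1 hi with rfl | hi
          · exact ⟨r, hrJ, (hP'r x).2 ⟨Or.inr hx, h1, h2⟩⟩
          · exact ⟨i, hi, (hP'n i h3 x).2 ⟨hx, h1, h2⟩⟩
        obtain ⟨i', hi', hx'⟩ := this
        obtain ⟨z, hz, hzx⟩ := hdom i' hi' x hx'
        exact ⟨z, by simp [hz], hzx⟩
    · have hlt : H₁.edgeSet.ncard < H.edgeSet.ncard := by
        apply Set.ncard_lt_ncard _ (Set.toFinite _)
        refine ⟨SimpleGraph.edgeSet_mono hle, fun hsub => ?_⟩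
        have : s(w, m) ∈ H₁.edgeSet := hsub (by simpa using hadj)
        simp [hH₁] at this
      obtain ⟨J, hJA, hrJ, Z, hZ, hdom⟩ := ih H₁ A P r hr (by omega) hP
        ⟨f, hf.1, fun i hi j hj h => hf.2 i hi j hj (hle h)⟩ hno₁
      refine ⟨J, hJA, hrJ, Z, hZ, fun i hi x hx => ?_⟩
      obtain ⟨z, hz, hzx⟩ := hdom i hi x hx
      exact ⟨z, hz, hle hzx⟩

open Classical in
/-- In a graph of maximum degree at most two, disjoint sets of size at least four have an
independent system of representatives. -/
theorem AtMostTwoNeighbors.exists_isISR {V : Type u} {ι : Type v} [Fintype V] {H : SimpleGraph V}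
    (hH : AtMostTwoNeighbors H) (P : ι → Finset V) (hcard : ∀ i, 4 ≤ (P i).card)
    (hP : ∀ i j x, x ∈ P i → x ∈ P j → i = j) (A : Finset ι) : ∃ f, IsISR H A P f := by
  have hnbr : ∀ z, (Finset.univ.filter fun x => H.Adj z x).card ≤ 2 := by
    intro z
    by_contra! h
    obtain ⟨a, b, c, ha, hb, hc, hab, hac, hbc⟩ := Finset.two_lt_card_iff.1 h
    simp only [Finset.mem_filter, Finset.mem_univ, true_and] at ha hb hc
    rcases hH z a b c ha hb hc with h | h | h <;> contradiction
  induction A using Finset.induction_on with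
  | empty =>
    rcases isEmpty_or_nonempty ι with h | ⟨⟨i⟩⟩
    · exact ⟨fun i => h.elim i, by simp [IsISR]⟩
    · obtain ⟨x, _⟩ := Finset.card_pos.1 (by have := hcard i; omega : 0 < (P i).card)
      exact ⟨fun _ => x, by simp [IsISR]⟩
  | insert r A hr ih =>
    by_contra hno
    obtain ⟨J, hJ, hrJ, Z, hZ, hdom⟩ := exists_dominating_of_not_isISR _ H (insert r A) P r
      (Finset.mem_insert_self _ _) le_rfl (fun i _ j _ => hP i j)
      (by rwa [Finset.erase_insert hr]) hno
    -- At least `4|J|` vertices would be dominated by `2(|J| - 1)` vertices with at most two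
    -- neighbours each.
    have h1 : J.biUnion P ⊆ Z.biUnion fun z => Finset.univ.filter fun x => H.Adj z x := by
      intro x hx
      obtain ⟨i, hi, hxi⟩ := Finset.mem_biUnion.1 hx
      obtain ⟨z, hz, hzx⟩ := hdom i hi x hxi
      exact Finset.mem_biUnion.2 ⟨z, hz, by simpa using hzx⟩
    have h2 : (J.biUnion P).card = ∑ i ∈ J, (P i).card :=
      Finset.card_biUnion fun i _ j _ hij => Finset.disjoint_left.2 fun x hx hx' =>
        hij (hP i j x hx hx')
    have h3 : J.card * 4 ≤ ∑ i ∈ J, (P i).card := by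
      simpa using Finset.card_nsmul_le_sum J (fun i => (P i).card) 4 fun i _ => hcard i
    have h4 := Finset.card_le_card h1
    have h5 := Finset.card_biUnion_le_card_mul Z
      (fun z => Finset.univ.filter fun x => H.Adj z x) 2 fun z _ => hnbr z
    have h6 := Finset.card_pos.2 ⟨r, hrJ⟩
    omega

/-! ### Matching blocks to classes with few links left over -/

open Classical in
/-- If `F` is matchable and `insert T F` is not, then there is a set `R ⊆ insert T F` violating
Hall's condition such that `(insert T F).erase X` is matchable for every `X ∈ R`. -/
theorem exists_hall_circuit {β : Type u} {K : Type v} (N : β → Finset K) {F : Finset β} {T : β}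
    (hF : ∀ R ⊆ F, R.card ≤ (R.biUnion N).card)
    (hT : ¬ ∀ R ⊆ insert T F, R.card ≤ (R.biUnion N).card) :
    ∃ R ⊆ insert T F, (R.biUnion N).card < R.card ∧
      ∀ X ∈ R, ∀ R' ⊆ (insert T F).erase X, R'.card ≤ (R'.biUnion N).card := by
  push Not at hT
  obtain ⟨R₀, hR₀, hv₀⟩ := hT
  let p : Finset β → Prop := fun R => R ⊆ insert T F ∧ (R.biUnion N).card < R.card
  obtain ⟨R, -, hR⟩ := exists_minimal_le_of_wellFoundedLT p R₀ ⟨hR₀, hv₀⟩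
  have hRv : (R.biUnion N).card < R.card := hR.prop.2
  refine ⟨R, hR.prop.1, hRv, fun X hX R' hR' => ?_⟩
  by_contra! hv
  have hXR' : X ∉ R' := fun h => by simpa using hR' h
  have hR'T : R' ⊆ insert T F := hR'.trans (Finset.erase_subset _ _)
  -- Neighbourhood size is submodular, and `R ∪ R'` has deficiency at most one because dropping `T`
  -- leaves a subset of `F`. So `R ∩ R'` also violates Hall's condition, and minimality forces `R ⊆
  -- R'`, although `X ∉ R'`.
  have h1 : ((R ∪ R').biUnion N).card + ((R ∩ R').biUnion N).card ≤
      (R.biUnion N).card + (R'.biUnion N).card := by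
    rw [← Finset.card_union_add_card_inter (R.biUnion N), Finset.union_biUnion]
    refine Nat.add_le_add_left (Finset.card_le_card ?_) _
    intro k hk
    simp only [Finset.mem_biUnion, Finset.mem_inter] at hk ⊢
    obtain ⟨b, ⟨h, h'⟩, hb⟩ := hk
    exact ⟨⟨b, h, hb⟩, ⟨b, h', hb⟩⟩
  have h2 := Finset.card_union_add_card_inter R R'
  have h3 : (R ∪ R').card ≤ ((R ∪ R').biUnion N).card + 1 := by
    have h4 := hF ((R ∪ R').erase T) (by
      rw [← Finset.subset_insert_iff]
      exact Finset.union_subset hR.prop.1 hR'T)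
    have h5 : (((R ∪ R').erase T).biUnion N).card ≤ ((R ∪ R').biUnion N).card :=
      Finset.card_le_card (Finset.biUnion_subset_biUnion_of_subset_left _ (Finset.erase_subset _ _))
    have h6 := Finset.pred_card_le_card_erase (s := R ∪ R') (a := T)
    omega
  have h7 : p (R ∩ R') := ⟨Finset.inter_subset_left.trans hR.prop.1, by omega⟩
  have h8 := hR.le_of_le h7 Finset.inter_subset_left
  exact hXR' (Finset.mem_inter.1 (h8 hX)).2

/-- Two distinct blocks are linked if some class meets both of them and contains a vertex outside
the blocks in `τ`. -/
def Linked {V : Type u} {K : Type v} {β : Type w} (κ : V → K) (I : β → Finset V) (τ : Finset β)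
    (b b' : β) : Prop :=
  b ≠ b' ∧ ∃ x ∈ I b, ∃ y ∈ I b', ∃ z, κ x = κ y ∧ κ z = κ x ∧ ∀ c ∈ τ, z ∉ I c

theorem Linked.symm {V : Type u} {K : Type v} {β : Type w} {κ : V → K} {I : β → Finset V}
    {τ : Finset β} {b b' : β} (h : Linked κ I τ b b') : Linked κ I τ b' b := by
  obtain ⟨hne, x, hx, y, hy, z, h1, h2, h3⟩ := h
  exact ⟨hne.symm, y, hy, x, hx, z, h1.symm, h2.trans h1, h3⟩

open Classical in
/-- The set of blocks in `U` linked to `b`. -/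
noncomputable def linkedTo {V : Type u} {K : Type v} {β : Type w} (κ : V → K) (I : β → Finset V)
    (τ U : Finset β) (b : β) : Finset β :=
  U.filter fun b' => Linked κ I τ b b'

-- Linking is symmetric and the sum counts each linked pair twice; this makes the effect of
-- exchanging one block computable.
open Classical in
theorem sum_linkedTo_insert {V : Type u} {K : Type v} {β : Type w} (κ : V → K)
    (I : β → Finset V) (τ : Finset β) {W : Finset β} {b : β} (hb : b ∉ W) :
    ∑ c ∈ insert b W, (linkedTo κ I τ (insert b W) c).card =
      ∑ c ∈ W, (linkedTo κ I τ W c).card + 2 * (linkedTo κ I τ W b).card := by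
  have h0 : ∀ c, (linkedTo κ I τ (insert b W) c).card =
      (if Linked κ I τ c b then 1 else 0) + (linkedTo κ I τ W c).card := by
    intro c
    simp only [linkedTo, Finset.filter_insert]
    split_ifs with h
    · rw [Finset.card_insert_of_notMem (by simp [hb]), add_comm]
    · simp
  have h1 : ¬ Linked κ I τ b b := fun h => h.1 rfl
  have h2 : ∑ c ∈ W, (if Linked κ I τ c b then 1 else 0) = (linkedTo κ I τ W b).card := by
    rw [linkedTo, Finset.card_filter]
    refine Finset.sum_congr rfl fun c _ => ?_
    have : Linked κ I τ c b ↔ Linked κ I τ b c := ⟨Linked.symm, Linked.symm⟩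
    simp [this]
  rw [Finset.sum_insert hb, h0 b]
  simp only [h0, Finset.sum_add_distrib, h2, if_neg h1]
  ring

open Classical in
/-- The counting step: a set `R` of disjoint blocks of size four, or three for those in `τ`, whose
vertices meet fewer than `|R|` classes of size four, contains a block in `τ` that is linked to at
most one block in `W`, for every `W ⊆ τ` disjoint from `R`. -/
theorem exists_card_linkedTo_le_one {V : Type u} {K : Type v} {β : Type w} [Fintype V]
    {κ : V → K} (hκ : ∀ k, (Finset.univ.filter fun x => κ x = k).card ≤ 4)
    {I : β → Finset V} (hI : ∀ b b' x, x ∈ I b → x ∈ I b' → b = b') {τ : Finset β}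
    (h3 : ∀ b ∈ τ, 3 ≤ (I b).card) (h4 : ∀ b ∉ τ, 4 ≤ (I b).card) {R W : Finset β}
    (hR : (R.biUnion fun b => (I b).image κ).card < R.card) (hW : W ⊆ τ) (hRW : Disjoint R W) :
    ∃ b ∈ R, b ∈ τ ∧ (linkedTo κ I τ W b).card ≤ 1 := by
  by_contra! hcon
  set N := R.biUnion fun b => (I b).image κ with hN
  -- Holes take up room in the classes met by `R`. If every block of `R` in `τ` had two links into
  -- `W`, there would be at least as many holes as such blocks, making up for their missing fourth
  -- vertices: the classes in `N` would hold at least `4|R| > 4|N|` vertices.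
  let holes : Finset V := (W.biUnion I).filter fun x => κ x ∈ N
  have hdisj : ∀ s : Finset β, (s.biUnion I).card = ∑ b ∈ s, (I b).card := fun s =>
    Finset.card_biUnion fun b _ b' _ hne => Finset.disjoint_left.2 fun x hx hx' =>
      hne (hI b b' x hx hx')
  have hsub : R.biUnion I ∪ holes ⊆ Finset.univ.filter fun x => κ x ∈ N := by
    intro x hx
    rcases Finset.mem_union.1 hx with hx | hx
    · obtain ⟨b, hb, hxb⟩ := Finset.mem_biUnion.1 hx
      simp only [hN, Finset.mem_filter, Finset.mem_univ, true_and, Finset.mem_biUnion]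
      exact ⟨b, hb, Finset.mem_image_of_mem _ hxb⟩
    · simpa using (Finset.mem_filter.1 hx).2
  have hdj : Disjoint (R.biUnion I) holes := by
    refine Finset.disjoint_left.2 fun x hx hx' => ?_
    obtain ⟨b, hb, hxb⟩ := Finset.mem_biUnion.1 hx
    obtain ⟨b', hb', hxb'⟩ := Finset.mem_biUnion.1 (Finset.mem_filter.1 hx').1
    exact Finset.disjoint_left.1 hRW hb (hI b b' x hxb hxb' ▸ hb')
  have hcap : (Finset.univ.filter fun x => κ x ∈ N).card ≤ N.card * 4 := by
    have : (Finset.univ.filter fun x => κ x ∈ N) =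
        N.biUnion fun k => Finset.univ.filter fun x => κ x = k := by
      ext x; simp
    rw [this]
    exact Finset.card_biUnion_le_card_mul _ _ _ fun k _ => hκ k
  have hcount : R.card * 4 ≤ ∑ b ∈ R, (I b).card + (R.filter (· ∈ τ)).card := by
    rw [Finset.card_filter, ← Finset.sum_add_distrib]
    have := Finset.card_nsmul_le_sum R (fun b => (I b).card + if b ∈ τ then 1 else 0) 4 (by
      intro b _
      by_cases hb : b ∈ τ
      · have := h3 b hb
        simp only [hb, if_true]; omega
      · have := h4 b hb
        simp only [hb, if_false]; omega)
    simpa using this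
  have hle := Finset.card_le_card hsub
  rw [Finset.card_union_of_disjoint hdj, hdisj] at hle
  let r : β → V → Prop := fun b y => ∃ x ∈ I b, ∃ z, κ x = κ y ∧ κ z = κ x ∧ ∀ c ∈ τ, z ∉ I c
  have hdouble := Finset.card_mul_le_card_mul (s := R.filter (· ∈ τ)) (t := holes) r
    (m := 2) (n := 2) (by
      intro b hb
      obtain ⟨hbR, hbτ⟩ := Finset.mem_filter.1 hb
      obtain ⟨b₁, hb₁, b₂, hb₂, hne⟩ := Finset.one_lt_card.1 (hcon b hbR hbτ)
      simp only [linkedTo, Finset.mem_filter] at hb₁ hb₂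
      obtain ⟨hb₁W, -, x₁, hx₁, y₁, hy₁, z₁, e₁, e₁', hz₁⟩ := hb₁
      obtain ⟨hb₂W, -, x₂, hx₂, y₂, hy₂, z₂, e₂, e₂', hz₂⟩ := hb₂
      have mem : ∀ b' ∈ W, ∀ x ∈ I b, ∀ y ∈ I b', κ x = κ y → y ∈ holes := by
        intro b' hb' x hx y hy e
        refine Finset.mem_filter.2 ⟨Finset.mem_biUnion.2 ⟨b', hb', hy⟩, ?_⟩
        rw [← e]
        exact Finset.mem_biUnion.2 ⟨b, hbR, Finset.mem_image_of_mem _ hx⟩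
      refine Finset.one_lt_card.2 ⟨y₁, ?_, y₂, ?_, ?_⟩
      · exact Finset.mem_filter.2 ⟨mem b₁ hb₁W x₁ hx₁ y₁ hy₁ e₁, x₁, hx₁, z₁, e₁, e₁', hz₁⟩
      · exact Finset.mem_filter.2 ⟨mem b₂ hb₂W x₂ hx₂ y₂ hy₂ e₂, x₂, hx₂, z₂, e₂, e₂', hz₂⟩
      · rintro rfl
        exact hne (hI _ _ _ hy₁ hy₂)) (by
      intro y hy
      obtain ⟨b', hb', hyb'⟩ := Finset.mem_biUnion.1 (Finset.mem_filter.1 hy).1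
      by_contra! hlt
      -- Three blocks related to one hole `y` would put five vertices in its class: `y`, one from
      -- each block, and `z` outside all blocks of `τ`.
      obtain ⟨b₁, b₂, b₃, m₁, m₂, m₃, n₁₂, n₁₃, n₂₃⟩ := Finset.two_lt_card_iff.1 hlt
      simp only [Finset.bipartiteBelow, Finset.mem_filter] at m₁ m₂ m₃
      obtain ⟨⟨R₁, t₁⟩, x₁, hx₁, z, e₁, ez, hz⟩ := m₁
      obtain ⟨⟨R₂, t₂⟩, x₂, hx₂, -, e₂, -⟩ := m₂
      obtain ⟨⟨R₃, t₃⟩, x₃, hx₃, -, e₃, -⟩ := m₃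
      have hn : ∀ b ∈ R, ∀ x ∈ I b, x ≠ y := by
        rintro b hb x hx rfl
        exact Finset.disjoint_left.1 hRW hb (hI b b' x hx hyb' ▸ hb')
      have hx : ∀ b c x x', b ≠ c → x ∈ I b → x' ∈ I c → x ≠ x' := by
        rintro b c x x' hbc h1 h2 rfl
        exact hbc (hI _ _ _ h1 h2)
      have hzn : ∀ b ∈ τ, ∀ x ∈ I b, z ≠ x := by
        rintro b hb x hx rfl
        exact hz b hb hx
      have hzy : z ≠ y := hzn b' (hW hb') y hyb'
      have h5 : ({z, y, x₁, x₂, x₃} : Finset V) ⊆ Finset.univ.filter fun x => κ x = κ y := by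
        intro x hx
        simp only [Finset.mem_insert, Finset.mem_singleton] at hx
        rcases hx with rfl | rfl | rfl | rfl | rfl <;> simp [*]
      have h6 := Finset.card_le_card h5
      rw [Finset.card_insert_of_notMem, Finset.card_insert_of_notMem,
        Finset.card_insert_of_notMem, Finset.card_insert_of_notMem, Finset.card_singleton] at h6
      · have := hκ (κ y)
        omega
      · simpa using hx _ _ _ _ n₂₃ hx₂ hx₃
      · simpa using ⟨hx _ _ _ _ n₁₂ hx₁ hx₂, hx _ _ _ _ n₁₃ hx₁ hx₃⟩
      · simpa using ⟨(hn _ R₁ _ hx₁).symm, (hn _ R₂ _ hx₂).symm, (hn _ R₃ _ hx₃).symm⟩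
      · simpa using ⟨hzy, hzn _ t₁ _ hx₁, hzn _ t₂ _ hx₂, hzn _ t₃ _ hx₃⟩)
  omega

open Classical in
/-- All blocks outside some `U ⊆ τ` have distinct representatives in distinct classes, where every
block in `U` is linked to at most one other block in `U`. -/
theorem exists_matching_linkedTo_le_one {V : Type u} {K : Type v} {β : Type w} [Fintype V]
    [Fintype β]
    {κ : V → K} (hκ : ∀ k, (Finset.univ.filter fun x => κ x = k).card ≤ 4)
    {I : β → Finset V} (hI : ∀ b b' x, x ∈ I b → x ∈ I b' → b = b') {τ : Finset β}
    (h3 : ∀ b ∈ τ, 3 ≤ (I b).card) (h4 : ∀ b ∉ τ, 4 ≤ (I b).card) :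
    ∃ U ⊆ τ, (∃ Q : Finset V, Set.InjOn κ Q ∧ ∀ b ∉ U, ∃ x ∈ Q, x ∈ I b) ∧
      ∀ b ∈ U, (linkedTo κ I τ U b).card ≤ 1 := by
  let N : β → Finset K := fun b => (I b).image κ
  let good : Finset β → Prop := fun U => U ⊆ τ ∧ ∀ R ⊆ Uᶜ, R.card ≤ (R.biUnion N).card
  have hgood : good τ := by
    refine ⟨subset_rfl, fun R hR => ?_⟩
    by_contra! h
    obtain ⟨b, hbR, hbτ, -⟩ := exists_card_linkedTo_le_one hκ hI h3 h4 h
      (Finset.empty_subset τ) (by simp)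
    exact Finset.mem_compl.1 (hR hbR) hbτ
  obtain ⟨U₁, hU₁, hmin₁⟩ := Set.exists_min_image {U | good U} Finset.card (Set.toFinite _)
    ⟨τ, hgood⟩
  obtain ⟨U, ⟨hU, hUc⟩, hmin⟩ := Set.exists_min_image {U | good U ∧ U.card = U₁.card}
    (fun U => ∑ c ∈ U, (linkedTo κ I τ U c).card) (Set.toFinite _) ⟨U₁, hU₁, rfl⟩
  refine ⟨U, hU.1, ?_, ?_⟩
  · have hall := (Finset.all_card_le_biUnion_card_iff_exists_injective
      (fun b : {b // b ∉ U} => N b)).1 (by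
        intro s
        have h := hU.2 (s.map (Function.Embedding.subtype _)) (by
          intro b hb
          obtain ⟨a, -, rfl⟩ := Finset.mem_map.1 hb
          simpa using a.2)
        rw [Finset.card_map, Finset.map_eq_image, Finset.image_biUnion] at h
        exact h)
    obtain ⟨g, hg, hgN⟩ := hall
    have hx : ∀ b, ∃ x ∈ I b.1, κ x = g b := fun b => Finset.mem_image.1 (hgN b)
    choose x hxI hxκ using hx
    refine ⟨Finset.univ.image x, ?_, fun b hb => ⟨x ⟨b, hb⟩, by simp, hxI ⟨b, hb⟩⟩⟩
    intro a ha a' ha' e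
    simp only [Finset.coe_image, Finset.coe_univ, Set.image_univ, Set.mem_range] at ha ha'
    obtain ⟨b, rfl⟩ := ha
    obtain ⟨b', rfl⟩ := ha'
    rw [hxκ, hxκ] at e
    rw [hg e]
  · intro T hT
    by_contra! htwo
    set W := U.erase T with hW
    have hTW : T ∉ W := Finset.notMem_erase _ _
    have hins : insert T W = U := Finset.insert_erase hT
    have hTτ := hU.1 hT
    have hWc : insert T Uᶜ = Wᶜ := by
      ext b; simp only [hW, Finset.mem_insert, Finset.mem_compl, Finset.mem_erase]; tauto
    have hWcard : W.card + 1 = U.card := Finset.card_erase_add_one hT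
    -- By minimality of `|U|`, `T` cannot be matched too. Any `X` in the resulting circuit may be
    -- left out instead; choosing it with at most one link into `W` keeps the size but lowers the
    -- link sum, as `T` has at least two.
    obtain ⟨R, hRsub, hRlt, hRX⟩ := exists_hall_circuit N (F := Uᶜ) (T := T) hU.2 (by
      intro h
      have : good W := ⟨(Finset.erase_subset _ _).trans hU.1, by rwa [← hWc]⟩
      have := hmin₁ W this
      omega)
    rw [hWc] at hRsub hRX
    obtain ⟨X, hXR, hXτ, hX⟩ := exists_card_linkedTo_le_one hκ hI h3 h4 hRlt
      ((Finset.erase_subset _ _).trans hU.1 : W ⊆ τ)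
      (Finset.disjoint_left.2 fun b hb => Finset.mem_compl.1 (hRsub hb))
    have hXW : X ∉ W := Finset.mem_compl.1 (hRsub hXR)
    have hgX : good (insert X W) := by
      refine ⟨Finset.insert_subset hXτ ((Finset.erase_subset _ _).trans hU.1), ?_⟩
      have : (insert X W)ᶜ = Wᶜ.erase X := by
        ext b; simp only [Finset.mem_insert, Finset.mem_compl, Finset.mem_erase]; tauto
      rw [this]
      exact hRX X hXR
    have h5 := hmin (insert X W) ⟨hgX, by
      rw [Finset.card_insert_of_notMem hXW, hWcard, hUc]⟩
    rw [← hins] at h5 htwo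
    have h6 : linkedTo κ I τ (insert T W) T = linkedTo κ I τ W T := by
      rw [linkedTo, Finset.filter_insert, if_neg fun h => h.1 rfl, linkedTo]
    rw [h6] at htwo
    have hX' : (linkedTo κ I τ W X).card ≤ 1 := hX
    rw [sum_linkedTo_insert κ I τ hXW, sum_linkedTo_insert κ I τ hTW] at h5
    omega

/-! ### Rerouting a transversal through the blocks -/

open Classical in
/-- An independent set meeting every full class once can be modified so as to meet, in addition,
every block whose representative in its interior `I b` belongs to the partial transversal `Q`. -/
theorem exists_independent_transversal_hitting {V : Type u} {K : Type v} {β : Type w} [Fintype V]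
    {H : SimpleGraph V} {κ : V → K} {F : Set K} {I D : β → Finset V} {B : Set β}
    (hID : ∀ b, I b ⊆ D b) (hnbr : ∀ b, ∀ x ∈ I b, ∀ y, H.Adj x y → y ∈ D b)
    {S₀ Q : Finset V} (hindep : ∀ x ∈ S₀, ∀ y ∈ S₀, ¬ H.Adj x y) (hinj : Set.InjOn κ S₀)
    (hfull : ∀ k ∈ F, ∃ x ∈ S₀, κ x = k) (hQ : Set.InjOn κ Q)
    (hQB : ∀ b ∈ B, ∃ x ∈ Q, x ∈ I b) :
    ∃ S : Finset V, (∀ x ∈ S, ∀ y ∈ S, ¬ H.Adj x y) ∧ Set.InjOn κ S ∧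
      (∀ k ∈ F, ∃ x ∈ S, κ x = k) ∧ ∀ b ∈ B, ∃ x ∈ S, x ∈ D b := by
  obtain ⟨S, ⟨h1, h2, h3⟩, hmax⟩ := Set.exists_max_image
    {S : Finset V | (∀ x ∈ S, ∀ y ∈ S, ¬ H.Adj x y) ∧ Set.InjOn κ S ∧ ∀ k ∈ F, ∃ x ∈ S, κ x = k}
    (fun S => (S ∩ Q).card) (Set.toFinite _) ⟨S₀, hindep, hinj, hfull⟩
  refine ⟨S, h1, h2, h3, fun b hb => ?_⟩
  by_contra! hmiss
  obtain ⟨q, hqQ, hqI⟩ := hQB b hb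
  have hqS : q ∉ S := fun h => hmiss q h (hID b hqI)
  have hqn : ∀ y ∈ S, ¬ H.Adj q y := fun y hy h => hmiss y hy (hnbr b q hqI y h)
  -- The neighbours of `q` lie in a block that `S` misses, so independence survives. A removed class
  -- mate of `q` is not in `Q`, which has one vertex per class, so `|S ∩ Q|` grows.
  set S' := insert q (S.filter fun x => κ x ≠ κ q) with hS'
  have h4 := hmax S' ⟨?_, ?_, ?_⟩
  · have h5 : insert q (S ∩ Q) ⊆ S' ∩ Q := by
      intro x hx
      rcases Finset.mem_insert.1 hx with rfl | hx
      · simp [hS', hqQ]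
      · obtain ⟨hxS, hxQ⟩ := Finset.mem_inter.1 hx
        have : κ x ≠ κ q := fun e => hqS (hQ hxQ hqQ e ▸ hxS)
        simp [hS', hxS, hxQ, this]
    have h6 := Finset.card_le_card h5
    rw [Finset.card_insert_of_notMem (by simp [hqS])] at h6
    omega
  · intro x hx y hy
    simp only [hS', Finset.mem_insert, Finset.mem_filter] at hx hy
    rcases hx with rfl | hx <;> rcases hy with rfl | hy
    · exact H.irrefl
    · exact hqn y hy.1
    · exact fun h => hqn x hx.1 h.symm
    · exact h1 x hx.1 y hy.1
  · intro x hx y hy e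
    simp only [hS', Finset.coe_insert, Finset.coe_filter, Set.mem_insert_iff,
      Set.mem_ofPred_eq] at hx hy
    rcases hx with rfl | hx <;> rcases hy with rfl | hy
    · rfl
    · exact absurd e.symm hy.2
    · exact absurd e hx.2
    · exact h2 hx.1 hy.1 e
  · intro k hk
    by_cases hkq : k = κ q
    · exact ⟨q, by simp [hS'], hkq.symm⟩
    · obtain ⟨x, hx, rfl⟩ := h3 k hk
      exact ⟨x, by simp [hS', hx, hkq], rfl⟩

/-! ### Components of graphs of maximum degree two -/

theorem mem_of_reachable_of_closed {V : Type u} {H : SimpleGraph V} {A : Set V}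
    (hA : ∀ y ∈ A, ∀ z, H.Adj y z → z ∈ A) {x y : V} (h : H.Reachable x y) (hx : x ∈ A) :
    y ∈ A := by
  obtain ⟨p⟩ := h
  induction p with
  | nil => exact hx
  | cons hadj _ ih => exact ih (hA _ hx _ hadj)

theorem supp_subset_of_closed {V : Type u} {H : SimpleGraph V} {C : H.ConnectedComponent}
    {A : Set V} (hA : ∀ y ∈ A, ∀ z, H.Adj y z → z ∈ A) {x : V} (hxC : x ∈ C.supp) (hx : x ∈ A) :
    C.supp ⊆ A := by
  intro y hy
  rw [SimpleGraph.ConnectedComponent.mem_supp_iff] at hxC hy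
  exact mem_of_reachable_of_closed hA (SimpleGraph.ConnectedComponent.exact (hxC.trans hy.symm)) hx

theorem mem_supp_of_adj {V : Type u} {H : SimpleGraph V} {C : H.ConnectedComponent} {x y : V}
    (hx : x ∈ C.supp) (h : H.Adj x y) : y ∈ C.supp := by
  rw [SimpleGraph.ConnectedComponent.mem_supp_iff] at hx ⊢
  rw [← hx]
  exact SimpleGraph.ConnectedComponent.sound h.symm.reachable

/-- The set `A` is listed without repetition as `p 0, …, p (m - 1)`, where consecutive vertices are
adjacent, and all adjacencies are between cyclically consecutive vertices. -/
structure IsCyclicListing {V : Type u} (H : SimpleGraph V) (A : Set V) (m : ℕ) (p : ℕ → V) :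
    Prop where
  pos : 0 < m
  mem_iff : ∀ x, x ∈ A ↔ ∃ i < m, p i = x
  inj : ∀ i < m, ∀ j < m, p i = p j → i = j
  adj_succ : ∀ i, i + 1 < m → H.Adj (p i) (p (i + 1))
  cases_of_adj : ∀ i < m, ∀ j < m, H.Adj (p i) (p j) →
    j = i + 1 ∨ i = j + 1 ∨ (i = 0 ∧ j + 1 = m) ∨ (j = 0 ∧ i + 1 = m)

/-- A longest path works, for paths and cycles alike: its inner vertices have both neighbours on it,
and an outside neighbour of an end would extend it. So it is closed under adjacency and exhausts the
component. -/
theorem AtMostTwoNeighbors.exists_isCyclicListing {V : Type u} [Finite V] {H : SimpleGraph V}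
    (hH : AtMostTwoNeighbors H) (C : H.ConnectedComponent) :
    ∃ m p, IsCyclicListing H C.supp m p := by
  let good : ℕ → (ℕ → V) → Prop := fun m p => (∀ i < m, p i ∈ C.supp) ∧
    (∀ i < m, ∀ j < m, p i = p j → i = j) ∧ ∀ i, i + 1 < m → H.Adj (p i) (p (i + 1))
  obtain ⟨x₀, hx₀⟩ := C.nonempty_supp
  have h1 : good 1 fun _ => x₀ :=
    ⟨fun _ _ => hx₀, fun i hi j hj _ => (by omega : i = j), fun i (hi : i + 1 < 1) => by omega⟩
  have hbdd : BddAbove {m | ∃ p, good m p} := by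
    refine ⟨Nat.card V, ?_⟩
    rintro m ⟨p, -, hinj, -⟩
    have := Nat.card_le_card_of_injective (fun i : Fin m => p i)
      fun i j h => Fin.ext (hinj i i.2 j j.2 h)
    simpa using this
  obtain ⟨m, ⟨p, hp⟩, hmax⟩ : ∃ m, (∃ p, good m p) ∧ ∀ m', (∃ p, good m' p) → m' ≤ m :=
    ⟨sSup {m | ∃ p, good m p}, Nat.sSup_mem (s := {m | ∃ p, good m p}) ⟨1, _, h1⟩ hbdd, fun m' h => le_csSup hbdd h⟩
  obtain ⟨hsupp, hinj, hadj⟩ := hp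
  have hpos : 0 < m := hmax 1 ⟨_, h1⟩
  have hinner : ∀ i, 0 < i → i + 1 < m → ∀ y, H.Adj (p i) y → y = p (i - 1) ∨ y = p (i + 1) := by
    intro i hi hi' y hy
    have ha := hadj (i - 1) (by omega)
    rw [Nat.sub_add_cancel hi] at ha
    rcases hH (p i) _ _ _ ha.symm (hadj i hi') hy with h | h | h
    · have := hinj _ (by omega) _ (by omega) h
      omega
    · exact Or.inl h.symm
    · exact Or.inr h.symm
  have hclosed : ∀ i < m, ∀ y, H.Adj (p i) y → ∃ j < m, p j = y := by
    intro i hi y hy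
    by_contra! hcon
    have hyC : y ∈ C.supp := mem_supp_of_adj (hsupp i hi) hy
    by_cases hi0 : i = 0
    · subst hi0
      have : m + 1 ≤ m := hmax (m + 1) ⟨fun j => if j = 0 then y else p (j - 1), ?_, ?_, ?_⟩
      · omega
      · intro j hj
        dsimp only
        split_ifs
        · exact hyC
        · exact hsupp _ (by omega)
      · intro j hj j' hj' e
        dsimp only at e
        split_ifs at e with h h' h'
        · omega
        · exact absurd e.symm (hcon _ (by omega))
        · exact absurd e (hcon _ (by omega))
        · have := hinj _ (by omega) _ (by omega) e
          omega
      · intro j hj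
        by_cases h : j = 0
        · subst h; simpa using hy.symm
        · have := hadj (j - 1) (by omega)
          rw [Nat.sub_add_cancel (by omega)] at this
          simpa [h] using this
    by_cases him : i + 1 = m
    · have : m + 1 ≤ m := hmax (m + 1) ⟨fun j => if j = m then y else p j, ?_, ?_, ?_⟩
      · omega
      · intro j hj
        dsimp only
        split_ifs
        · exact hyC
        · exact hsupp _ (by omega)
      · intro j hj j' hj' e
        dsimp only at e
        split_ifs at e with h h' h'
        · omega
        · exact absurd e.symm (hcon _ (by omega))
        · exact absurd e (hcon _ (by omega))
        · exact hinj _ (by omega) _ (by omega) e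
      · intro j hj
        by_cases h : j + 1 = m
        · have h' : j = i := by omega
          subst h'
          simpa [h, show j ≠ m by omega] using hy
        · simpa [h, show j ≠ m by omega] using hadj j (by omega)
    rcases hinner i (by omega) (by omega) y hy with h | h
    · exact hcon _ (by omega) h.symm
    · exact hcon _ (by omega) h.symm
  refine ⟨m, p, hpos, ?_, hinj, hadj, ?_⟩
  · intro x
    constructor
    · intro hx
      refine supp_subset_of_closed (A := {x | ∃ i < m, p i = x}) ?_ (hsupp 0 hpos) ⟨0, hpos, rfl⟩ hx
      rintro y ⟨i, hi, rfl⟩ z hz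
      exact hclosed i hi z hz
    · rintro ⟨i, hi, rfl⟩
      exact hsupp i hi
  · have key : ∀ i j, i < j → j < m → H.Adj (p i) (p j) → j = i + 1 ∨ (i = 0 ∧ j + 1 = m) := by
      intro i j hij hj h
      by_cases hi : i = 0
      · by_cases hjm : j + 1 = m
        · exact Or.inr ⟨hi, hjm⟩
        rcases hinner j (by omega) (by omega) _ h.symm with e | e
        · have := hinj _ (by omega) _ (by omega) e
          omega
        · have := hinj _ (by omega) _ (by omega) e
          omega
      · rcases hinner i (by omega) (by omega) _ h with e | e
        · have := hinj _ (by omega) _ (by omega) e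
          omega
        · have := hinj _ (by omega) _ (by omega) e
          omega
    intro i hi j hj h
    rcases lt_trichotomy i j with hij | rfl | hij
    · have := key i j hij hj h
      omega
    · exact absurd h H.irrefl
    · have := key j i hij hi h.symm
      omega

theorem IsCyclicListing.ncard_eq {V : Type u} {H : SimpleGraph V} {A : Set V} {m : ℕ} {p : ℕ → V}
    (h : IsCyclicListing H A m p) : A.ncard = m := by
  have : A = p '' Set.Iio m := by
    ext x; simp [h.mem_iff x]
  rw [this, Set.InjOn.ncard_image (s := Set.Iio m) fun i hi j hj e => h.inj i hi j hj e]
  simp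

/-- A component containing a vertex with at most one neighbour is a path. -/
theorem isPathOfLength_of_forall_adj_eq {V : Type u} [Finite V] {H : SimpleGraph V}
    (hH : AtMostTwoNeighbors H) {C : H.ConnectedComponent} {x : V} (hx : x ∈ C.supp)
    (hdeg : ∀ a b, H.Adj x a → H.Adj x b → a = b) : IsPathOfLength C (C.supp.ncard - 1) := by
  obtain ⟨m, p, h⟩ := hH.exists_isCyclicListing C
  have hpos := h.pos
  rw [h.ncard_eq]
  -- A wrap-around edge would give every vertex, including `x`, two neighbours.
  have hwrap : 3 ≤ m → ¬ H.Adj (p 0) (p (m - 1)) := by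
    intro hm hw
    obtain ⟨i, hi, rfl⟩ := (h.mem_iff x).1 hx
    have key : ∀ a b, a < m → b < m → H.Adj (p i) (p a) → H.Adj (p i) (p b) → a = b :=
      fun a b ha hb h1 h2 => h.inj a ha b hb (hdeg _ _ h1 h2)
    by_cases hi0 : i = 0
    · subst hi0
      have := key 1 (m - 1) (by omega) (by omega) (h.adj_succ 0 (by omega)) hw
      omega
    have h1 := h.adj_succ (i - 1) (by omega)
    rw [Nat.sub_add_cancel (by omega)] at h1
    by_cases him : i + 1 = m
    · have hi' : i = m - 1 := by omega
      have := key (i - 1) 0 (by omega) (by omega) h1.symm (by rw [hi']; exact hw.symm)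
      omega
    · have := key (i - 1) (i + 1) (by omega) (by omega) h1.symm (h.adj_succ i (by omega))
      omega
  let e : Fin (m - 1 + 1) → C := fun i => ⟨p i, (h.mem_iff _).2 ⟨i, by omega, rfl⟩⟩
  have he : Function.Bijective e := by
    constructor
    · intro i j hij
      exact Fin.ext (h.inj i (by omega) j (by omega) (congrArg Subtype.val hij))
    · rintro ⟨y, hy⟩
      obtain ⟨i, hi, rfl⟩ := (h.mem_iff y).1 hy
      exact ⟨⟨i, by omega⟩, rfl⟩
  refine ⟨(RelIso.symm ⟨Equiv.ofBijective e he, ?_⟩ : C.toSimpleGraph ≃g _)⟩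
  intro i j
  rw [SimpleGraph.pathGraph_adj]
  change H.Adj (p i) (p j) ↔ _
  have hi : i.1 < m := by omega
  have hj : j.1 < m := by omega
  constructor
  · intro hadj
    rcases h.cases_of_adj i hi j hj hadj with h1 | h1 | ⟨h1, h2⟩ | ⟨h1, h2⟩
    · exact Or.inl h1.symm
    · exact Or.inr h1.symm
    · by_cases hm : 3 ≤ m
      · refine absurd ?_ (hwrap hm)
        rwa [h1, show j.1 = m - 1 by omega] at hadj
      · have : i.1 ≠ j.1 := fun e => by rw [e] at hadj; exact H.irrefl hadj
        omega
    · by_cases hm : 3 ≤ m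
      · refine absurd ?_ (hwrap hm)
        rw [h1, show i.1 = m - 1 by omega] at hadj
        exact hadj.symm
      · have : i.1 ≠ j.1 := fun e => by rw [e] at hadj; exact H.irrefl hadj
        omega
  · rintro (h1 | h1)
    · rw [← h1]; exact h.adj_succ i (by omega)
    · rw [← h1]; exact (h.adj_succ j (by omega)).symm

theorem isTriangle_iff {V : Type u} {H : SimpleGraph V} {C : H.ConnectedComponent} :
    IsTriangle C ↔ ∃ a b c, H.Adj a b ∧ H.Adj a c ∧ H.Adj b c ∧ C.supp = {a, b, c} := by
  constructor
  · rintro ⟨e⟩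
    have hadj : ∀ i j : Fin 3, i ≠ j → H.Adj (e.symm i).1 (e.symm j).1 := by
      intro i j hij
      have : C.toSimpleGraph.Adj (e.symm i) (e.symm j) := by
        rw [e.symm.map_adj_iff]; exact hij
      exact this
    refine ⟨(e.symm 0).1, (e.symm 1).1, (e.symm 2).1, hadj _ _ (by decide), hadj _ _ (by decide),
      hadj _ _ (by decide), ?_⟩
    ext x
    simp only [Set.mem_insert_iff, Set.mem_singleton_iff]
    constructor
    · intro hx
      have hx' : x = (e.symm (e ⟨x, hx⟩)).1 := by rw [e.symm_apply_apply]
      generalize e ⟨x, hx⟩ = i at hx'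
      subst hx'
      fin_cases i <;> simp
    · rintro (rfl | rfl | rfl)
      exacts [(e.symm 0).2, (e.symm 1).2, (e.symm 2).2]
  · rintro ⟨a, b, c, hab, hac, hbc, hC⟩
    have hcard : Nat.card C.supp = 3 := by
      rw [Nat.card_coe_set_eq, hC, Set.ncard_eq_three]
      exact ⟨a, b, c, hab.ne, hac.ne, hbc.ne, rfl⟩
    have := Nat.finite_of_card_ne_zero (by rw [hcard]; norm_num : Nat.card C.supp ≠ 0)
    let e : C.supp ≃ Fin 3 := Finite.equivFinOfCardEq hcard
    refine ⟨⟨e, ?_⟩⟩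
    rintro ⟨x, hx⟩ ⟨y, hy⟩
    change e _ ≠ e _ ↔ H.Adj x y
    rw [e.injective.ne_iff, ne_eq, Subtype.mk.injEq]
    change x ∈ C.supp at hx
    change y ∈ C.supp at hy
    rw [hC] at hx hy
    constructor
    · intro hne
      rcases hx with rfl | rfl | rfl <;> rcases hy with rfl | rfl | rfl <;>
        first | exact absurd rfl hne | assumption | (apply SimpleGraph.Adj.symm; assumption)
    · exact fun h => h.ne

/-- Three mutually adjacent vertices form a component. -/
theorem AtMostTwoNeighbors.supp_eq_of_adj {V : Type u} {H : SimpleGraph V}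
    (hH : AtMostTwoNeighbors H) {C : H.ConnectedComponent} {a b c : V} (ha : a ∈ C.supp)
    (hab : H.Adj a b) (hac : H.Adj a c) (hbc : H.Adj b c) : C.supp = {a, b, c} := by
  apply Set.Subset.antisymm
  · refine supp_subset_of_closed ?_ ha (by simp)
    rintro y (rfl | rfl | rfl) z hz
    · have := hH _ _ _ _ hab hac hz
      have := hbc.ne
      simp only [Set.mem_insert_iff, Set.mem_singleton_iff]
      grind
    · have := hH _ _ _ _ hab.symm hbc hz
      have := hac.ne
      simp only [Set.mem_insert_iff, Set.mem_singleton_iff]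
      grind
    · have := hH _ _ _ _ hac.symm hbc.symm hz
      have := hab.ne
      simp only [Set.mem_insert_iff, Set.mem_singleton_iff]
      grind
  · rintro y (rfl | rfl | rfl)
    exacts [ha, mem_supp_of_adj ha hab, mem_supp_of_adj ha hac]

/-! ### Cutting components into blocks -/

/-- With `s` listing deleted positions, this locates the piece containing a surviving index.
Monotonicity of `s` is not needed. -/
theorem exists_gap (s : ℕ → ℕ) (n i : ℕ) (hi : ∀ j ≤ n, i ≠ s j) :
    i < s 0 ∨ (∃ j < n, s j < i ∧ i < s (j + 1)) ∨ s n < i := by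
  induction n with
  | zero => have := hi 0 le_rfl; omega
  | succ n ih =>
    rcases ih fun j hj => hi j (by omega) with h | ⟨j, hj, h⟩ | h
    · exact Or.inl h
    · exact Or.inr (Or.inl ⟨j, by omega, h⟩)
    · rcases lt_or_gt_of_ne (hi (n + 1) le_rfl) with h' | h'
      · exact Or.inr (Or.inl ⟨n, by omega, h, h'⟩)
      · exact Or.inr (Or.inr h')

open Classical in
/-- A component has disjoint blocks `D j` with subsets `I j` of at least four vertices all of
whose neighbours are in `D j`, such that removing a set that meets all blocks leaves only pieces of
at most thirteen vertices. -/
theorem IsCyclicListing.exists_blocks {V : Type u} {H : SimpleGraph V} {A : Set V} {m : ℕ}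
    {p : ℕ → V} (h : IsCyclicListing H A m p) :
    ∃ (k : ℕ) (D I : Fin k → Finset V), (∀ j, I j ⊆ D j) ∧ (∀ j, ∀ x ∈ D j, x ∈ A) ∧
      (∀ i j x, x ∈ D i → x ∈ D j → i = j) ∧ (∀ j, 4 ≤ (I j).card) ∧
      (∀ j, ∀ x ∈ I j, ∀ y, y ∈ A → H.Adj x y → y ∈ D j) ∧ (4 ≤ m → 0 < k) ∧
      ∀ S : Finset V, (∀ j, ∃ s ∈ S, s ∈ D j) → ∀ x ∈ A, x ∉ S →
        ∃ B : Finset V, x ∈ B ∧ B.card ≤ 13 ∧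
          ∀ y ∈ B, ∀ z ∈ A, z ∉ S → H.Adj y z → z ∈ B := by
  have hwhole : m ≤ 13 → ∀ S : Finset V, ∀ x ∈ A, x ∉ S → ∃ B : Finset V, x ∈ B ∧ B.card ≤ 13 ∧
      ∀ y ∈ B, ∀ z ∈ A, z ∉ S → H.Adj y z → z ∈ B := by
    intro hm S x hx _
    refine ⟨(Finset.range m).image p, ?_, Finset.card_image_le.trans (by simpa using hm), ?_⟩
    · simpa using (h.mem_iff x).1 hx
    · intro _ _ z hz _ _
      simpa using (h.mem_iff z).1 hz
  by_cases hm4 : m < 4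
  · exact ⟨0, Fin.elim0, Fin.elim0, fun j => j.elim0, fun j => j.elim0, fun j => j.elim0,
      fun j => j.elim0, fun j => j.elim0, by omega, fun S _ => hwhole (by omega) S⟩
  -- With four or five vertices there is no room for a window of six; the whole component is its own
  -- interior.
  by_cases hm6 : m < 6
  · have hmem : ∀ x, x ∈ (Finset.range m).image p ↔ x ∈ A := by
      intro x; simp [h.mem_iff x]
    refine ⟨1, fun _ => (Finset.range m).image p, fun _ => (Finset.range m).image p,
      fun _ => subset_rfl, fun _ x hx => (hmem x).1 hx, fun i j _ _ _ => Subsingleton.elim _ _, ?_,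
      fun _ _ _ y hy _ => (hmem y).2 hy, by omega, fun S _ => hwhole (by omega) S⟩
    intro _
    rw [Finset.card_image_of_injOn fun i hi j hj e =>
      h.inj i (by simpa using hi) j (by simpa using hj) e]
    simpa using hm4
  -- Windows of six start at the evenly spread positions `⌊jm/k⌋`, and their middle four positions
  -- form the interior. For `k ≥ 2`, `m ≤ 6k + 5 < 9k`, so successive starts are 6 to 9 apart, and
  -- hits in successive windows enclose at most `9 + 5 - 1 = 13` positions.
  set k := m / 6 with hk
  have hk6 : k * 6 ≤ m := Nat.div_mul_le_self m 6
  have hk0 : 0 < k := Nat.div_pos (by omega) (by norm_num)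
  let b : ℕ → ℕ := fun j => j * m / k
  have hb0 : b 0 = 0 := by simp [b]
  have hbk : b k = m := Nat.mul_div_cancel_left m hk0
  have hmk : 6 ≤ m / k := (Nat.le_div_iff_mul_le hk0).2 (by omega)
  have hstep : ∀ j, b j + 6 ≤ b (j + 1) := by
    intro j
    have : j * m / k + m / k ≤ (j * m + m) / k := Nat.div_add_div_le_add_div
    have h2 : b (j + 1) = (j * m + m) / k := by simp only [b, Nat.succ_mul]
    simp only [b] at h2 ⊢
    omega
  have hstep' : 2 ≤ k → ∀ j, b (j + 1) ≤ b j + 9 := by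
    intro hk2 j
    have h1 : m / k < 9 := (Nat.div_lt_iff_lt_mul hk0).2 (by omega)
    have h2 : b (j + 1) = (j * m + m) / k := by simp only [b, Nat.succ_mul]
    have h3 : (j * m + m) / k ≤ j * m / k + m / k + 1 := by
      rw [Nat.add_div hk0]
      split_ifs <;> omega
    simp only [b] at h2 ⊢
    omega
  have hmono : Monotone b := monotone_nat_of_le_succ fun j => by have := hstep j; omega
  have hlt : ∀ j < k, b j + 6 ≤ m := fun j hj => by
    have := hmono (show j + 1 ≤ k from hj)
    have := hstep j
    omega
  let D : Fin k → Finset V := fun j => (Finset.Ico (b j) (b j + 6)).image p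
  let I : Fin k → Finset V := fun j => (Finset.Ico (b j + 1) (b j + 5)).image p
  have hD : ∀ j x, x ∈ D j ↔ ∃ i, b j ≤ i ∧ i < b j + 6 ∧ p i = x := by
    intro j x; simp [D, and_assoc]
  have hI : ∀ j x, x ∈ I j ↔ ∃ i, b j + 1 ≤ i ∧ i < b j + 5 ∧ p i = x := by
    intro j x; simp [I, and_assoc]
  refine ⟨k, D, I, ?_, ?_, ?_, ?_, ?_, fun _ => hk0, ?_⟩
  · intro j x hx
    obtain ⟨i, h1, h2, h3⟩ := (hI j x).1 hx
    exact (hD j x).2 ⟨i, by omega, by omega, h3⟩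
  · intro j x hx
    obtain ⟨i, h1, h2, h3⟩ := (hD j x).1 hx
    exact (h.mem_iff x).2 ⟨i, by have := hlt j j.2; omega, h3⟩
  · intro j j' x hx hx'
    obtain ⟨i, h1, h2, h3⟩ := (hD j x).1 hx
    obtain ⟨i', h1', h2', h3'⟩ := (hD j' x).1 hx'
    have hj := hlt j j.2
    have hj' := hlt j' j'.2
    have hii := h.inj i (by omega) i' (by omega) (h3.trans h3'.symm)
    by_contra hne
    rcases lt_or_gt_of_ne fun e => hne (Fin.ext e) with hl | hl
    · have := hmono (show j.1 + 1 ≤ j'.1 from hl)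
      have := hstep j
      omega
    · have := hmono (show j'.1 + 1 ≤ j.1 from hl)
      have := hstep j'
      omega
  · intro j
    have hj := hlt j j.2
    rw [Finset.card_image_of_injOn]
    · simp
    · intro i hi i' hi' e
      simp only [Finset.coe_Ico, Set.mem_Ico] at hi hi'
      exact h.inj i (by omega) i' (by omega) e
  · intro j x hx y hy hadj
    have hj := hlt j j.2
    obtain ⟨i, h1, h2, rfl⟩ := (hI j x).1 hx
    obtain ⟨i', h1', rfl⟩ := (h.mem_iff y).1 hy
    have := h.cases_of_adj i (by omega) i' h1' hadj
    exact (hD j _).2 ⟨i', by omega, by omega, rfl⟩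
  · intro S hS x hx hxS
    by_cases hm13 : m ≤ 13
    · exact hwhole hm13 S x hx hxS
    have hk2 : 2 ≤ k := by omega
    have hs : ∀ j, ∃ i, j < k → b j ≤ i ∧ i < b j + 6 ∧ p i ∈ S := by
      intro j
      by_cases hj : j < k
      · obtain ⟨s, hsS, hsD⟩ := hS ⟨j, hj⟩
        obtain ⟨i, h1, h2, rfl⟩ := (hD _ _).1 hsD
        exact ⟨i, fun _ => ⟨h1, h2, hsS⟩⟩
      · exact ⟨0, fun h => absurd h hj⟩
    choose s hs using hs
    have hsm : ∀ j < k, s j < m := fun j hj => by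
      have := hlt j hj
      have := hs j hj
      omega
    obtain ⟨i, him, rfl⟩ := (h.mem_iff x).1 hx
    have hns : ∀ i' < m, p i' ∉ S → ∀ j < k, i' ≠ s j := by
      rintro i' - hi' j hj rfl
      exact hi' (hs j hj).2.2
    -- On a cycle the stretches before the first and after the last hit may join up, so they are
    -- taken together: at most `5 + 8` vertices.
    have hwrap : ∀ i' < m, (i' < s 0 ∨ s (k - 1) < i') → ∃ B : Finset V, p i' ∈ B ∧ B.card ≤ 13 ∧
        ∀ y ∈ B, ∀ z ∈ A, z ∉ S → H.Adj y z → z ∈ B := by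
      intro i' hi' hor
      have h1 := hs 0 hk0
      have h2 := hs (k - 1) (by omega)
      have h3 := hstep' hk2 (k - 1)
      rw [Nat.sub_add_cancel hk0, hbk] at h3
      refine ⟨(Finset.range (s 0) ∪ Finset.Ioo (s (k - 1)) m).image p, ?_, ?_, ?_⟩
      · refine Finset.mem_image_of_mem _ ?_
        simp only [Finset.mem_union, Finset.mem_range, Finset.mem_Ioo]
        omega
      · refine Finset.card_image_le.trans ((Finset.card_union_le _ _).trans ?_)
        simp only [Finset.card_range, Nat.card_Ioo]
        omega
      · intro y hy z hz hzS hadj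
        obtain ⟨a, ha, rfl⟩ := Finset.mem_image.1 hy
        obtain ⟨c, hc, rfl⟩ := (h.mem_iff z).1 hz
        simp only [Finset.mem_union, Finset.mem_range, Finset.mem_Ioo] at ha
        refine Finset.mem_image_of_mem _ ?_
        simp only [Finset.mem_union, Finset.mem_range, Finset.mem_Ioo]
        have h4 := hns c hc hzS 0 hk0
        have h5 := hns c hc hzS (k - 1) (by omega)
        have h6 := hsm 0 hk0
        have h8 := hsm (k - 1) (by omega)
        have h7 := h.cases_of_adj a (by omega) c hc hadj
        omega
    rcases exists_gap s (k - 1) i fun j hj => hns i him hxS j (by omega) with hg | ⟨j, hj, hg⟩ | hg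
    · exact hwrap i him (Or.inl hg)
    · have h1 := hs j (by omega)
      have h2 := hs (j + 1) (by omega)
      have h3 := hstep' hk2 j
      have h4 := hsm (j + 1) (by omega)
      refine ⟨(Finset.Ioo (s j) (s (j + 1))).image p, ?_, ?_, ?_⟩
      · exact Finset.mem_image_of_mem _ (Finset.mem_Ioo.2 hg)
      · refine Finset.card_image_le.trans ?_
        rw [Nat.card_Ioo]
        omega
      · intro y hy z hz hzS hadj
        obtain ⟨a, ha, rfl⟩ := Finset.mem_image.1 hy
        obtain ⟨c, hc, rfl⟩ := (h.mem_iff z).1 hz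
        rw [Finset.mem_Ioo] at ha
        refine Finset.mem_image_of_mem _ (Finset.mem_Ioo.2 ?_)
        have h5 := hns c hc hzS j (by omega)
        have h6 := hns c hc hzS (j + 1) (by omega)
        have h7 := h.cases_of_adj a (by omega) c hc hadj
        omega
    · exact hwrap i him (Or.inr hg)

open Classical in
theorem IsTriangle.card_toFinset {V : Type u} [Fintype V] {H : SimpleGraph V}
    {C : H.ConnectedComponent} (hC : IsTriangle C) : C.supp.toFinset.card = 3 := by
  obtain ⟨a, b, c, hab, hac, hbc, hC⟩ := isTriangle_iff.1 hC
  rw [← Set.ncard_eq_toFinset_card', hC, Set.ncard_eq_three]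
  exact ⟨a, b, c, hab.ne, hac.ne, hbc.ne, rfl⟩

theorem IsTriangle.adj {V : Type u} {H : SimpleGraph V}
    {C : H.ConnectedComponent} (hC : IsTriangle C) {x y : V} (hx : x ∈ C.supp) (hy : y ∈ C.supp)
    (hne : x ≠ y) : H.Adj x y := by
  obtain ⟨a, b, c, hab, hac, hbc, hC⟩ := isTriangle_iff.1 hC
  rw [hC] at hx hy
  rcases hx with rfl | rfl | rfl <;> rcases hy with rfl | rfl | rfl <;>
    first | exact absurd rfl hne | assumption | (apply SimpleGraph.Adj.symm; assumption)

open Classical in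
/-- The blocks of a component: a triangle is a single block. -/
theorem AtMostTwoNeighbors.exists_blocks {V : Type u} [Fintype V] {H : SimpleGraph V}
    (hH : AtMostTwoNeighbors H) (C : H.ConnectedComponent) :
    ∃ (k : ℕ) (D I : Fin k → Finset V), (∀ j, I j ⊆ D j) ∧ (∀ j, ∀ x ∈ D j, x ∈ C.supp) ∧
      (∀ i j x, x ∈ D i → x ∈ D j → i = j) ∧ (∀ j, 3 ≤ (I j).card) ∧
      (∀ j, ∀ x ∈ I j, ∀ y, H.Adj x y → y ∈ D j) ∧
      (IsTriangle C → 0 < k ∧ ∀ j, ∀ x ∈ C.supp, x ∈ I j) ∧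
      (¬ IsTriangle C → (∀ j, 4 ≤ (I j).card) ∧ (4 ≤ C.supp.ncard → 0 < k) ∧
        ∀ S : Finset V, (∀ j, ∃ s ∈ S, s ∈ D j) → ∀ x ∈ C.supp, x ∉ S →
          ∃ B : Finset V, x ∈ B ∧ B.card ≤ 13 ∧
            ∀ y ∈ B, ∀ z ∈ C.supp, z ∉ S → H.Adj y z → z ∈ B) := by
  by_cases hC : IsTriangle C
  · refine ⟨1, fun _ => C.supp.toFinset, fun _ => C.supp.toFinset, fun _ => subset_rfl,
      fun _ x hx => by simpa using hx, fun i j _ _ _ => Subsingleton.elim _ _, ?_, ?_, ?_,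
      fun h => absurd hC h⟩
    · intro _
      rw [hC.card_toFinset]
    · intro _ x hx y hy
      rw [Set.mem_toFinset] at hx ⊢
      exact mem_supp_of_adj hx hy
    · exact fun _ => ⟨Nat.one_pos, fun _ x hx => by rwa [Set.mem_toFinset]⟩
  · obtain ⟨m, p, h⟩ := hH.exists_isCyclicListing C
    obtain ⟨k, D, I, h1, h2, h3, h4, h5, h6, h7⟩ := h.exists_blocks
    refine ⟨k, D, I, h1, h2, h3, fun j => (h4 j).trans' (by norm_num), ?_, fun h => absurd h hC,
      fun _ => ⟨h4, by rwa [h.ncard_eq], h7⟩⟩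
    exact fun j x hx y hy => h5 j x hx y (mem_supp_of_adj (h2 j x (h1 j hx)) hy) hy

/-! ### Classes and the final transversal -/

open Classical in
/-- The class of a vertex: the index of the glued-in graph containing it, or the vertex itself. -/
noncomputable def gluedClass {V : Type u} {q k : ℕ} (f : (Σ _ : Fin q, Fin k) ↪ V) (x : V) :
    Fin q ⊕ V :=
  if h : ∃ t, f t = x then Sum.inl h.choose.1 else Sum.inr x

theorem gluedClass_apply {V : Type u} {q k : ℕ} (f : (Σ _ : Fin q, Fin k) ↪ V)
    (t : Σ _ : Fin q, Fin k) : gluedClass f (f t) = Sum.inl t.1 := by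
  have h : ∃ s, f s = f t := ⟨t, rfl⟩
  rw [gluedClass, dif_pos h, f.injective h.choose_spec]

theorem gluedClass_apply_eq {V : Type u} {q k : ℕ} (f : (Σ _ : Fin q, Fin k) ↪ V) (i : Fin q)
    (a b : Fin k) : gluedClass f (f ⟨i, a⟩) = gluedClass f (f ⟨i, b⟩) := by
  rw [gluedClass_apply, gluedClass_apply]

theorem exists_of_gluedClass_eq_inl {V : Type u} {q k : ℕ} (f : (Σ _ : Fin q, Fin k) ↪ V) {x : V}
    {i : Fin q} (hx : gluedClass f x = Sum.inl i) : ∃ a, f ⟨i, a⟩ = x := by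
  by_cases h : ∃ t, f t = x
  · obtain ⟨⟨j, a⟩, rfl⟩ := h
    rw [gluedClass_apply] at hx
    obtain rfl : j = i := Sum.inl_injective hx
    exact ⟨a, rfl⟩
  · rw [gluedClass, dif_neg h] at hx
    cases hx

theorem eq_of_gluedClass_eq_inr {V : Type u} {q k : ℕ} (f : (Σ _ : Fin q, Fin k) ↪ V) {x y : V}
    (hx : gluedClass f x = Sum.inr y) : x = y := by
  by_cases h : ∃ t, f t = x
  · rw [gluedClass, dif_pos h] at hx
    cases hx
  · rw [gluedClass, dif_neg h] at hx
    exact Sum.inr_injective hx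

open Classical in
theorem card_gluedClass_le {V : Type u} [Fintype V] {q : ℕ} (f : (Σ _ : Fin q, Fin 4) ↪ V)
    (k : Fin q ⊕ V) : (Finset.univ.filter fun x => gluedClass f x = k).card ≤ 4 := by
  rcases k with i | y
  · have : (Finset.univ.filter fun x => gluedClass f x = Sum.inl i) ⊆
        Finset.univ.image fun a : Fin 4 => f ⟨i, a⟩ := by
      intro x hx
      obtain ⟨a, ha⟩ := exists_of_gluedClass_eq_inl f (Finset.mem_filter.1 hx).2
      simpa using ⟨a, ha⟩
    exact (Finset.card_le_card this).trans Finset.card_image_le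
  · have : (Finset.univ.filter fun x => gluedClass f x = Sum.inr y) ⊆ {y} := by
      intro x hx
      simpa using eq_of_gluedClass_eq_inr f (Finset.mem_filter.1 hx).2
    exact (Finset.card_le_card this).trans (by simp)

open Classical in
/-- A graph with maximum degree at most two has an independent set that meets every glued-in `K₄`
exactly once, whose removal leaves only triangles and small pieces, with few links between the
triangles. -/
theorem AtMostTwoNeighbors.exists_transversal {V : Type u} [Fintype V] {H : SimpleGraph V}
    (hH : AtMostTwoNeighbors H) {q : ℕ} (f : (Σ _ : Fin q, Fin 4) ↪ V) :
    ∃ S : Finset V, (∀ x ∈ S, ∀ y ∈ S, ¬ H.Adj x y) ∧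
      (∀ i, ∃ a, f ⟨i, a⟩ ∈ S ∧ ∀ b, f ⟨i, b⟩ ∈ S → b = a) ∧
      (∀ C : H.ConnectedComponent, ¬ IsTriangle C →
        (4 ≤ C.supp.ncard → ∃ s ∈ S, s ∈ C.supp) ∧
        ∀ x ∈ C.supp, x ∉ S → ∃ B : Finset V, x ∈ B ∧ B.card ≤ 13 ∧
          ∀ y ∈ B, ∀ z ∈ C.supp, z ∉ S → H.Adj y z → z ∈ B) ∧
      ∀ C : H.ConnectedComponent, ∀ C' : Bool → H.ConnectedComponent,
        IsTriangle C → (∀ s ∈ S, s ∉ C.supp) →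
        (∀ j, IsTriangle (C' j) ∧ (∀ s ∈ S, s ∉ (C' j).supp) ∧ C' j ≠ C ∧
          ∃ i a b c, f ⟨i, a⟩ ∈ C.supp ∧ f ⟨i, b⟩ ∈ (C' j).supp ∧
            ¬ IsTriangle (H.connectedComponentMk (f ⟨i, c⟩))) →
        C' true = C' false := by
  choose k D I hID hDC hDdisj hI3 hnbr htri hnontri using hH.exists_blocks
  let β := Σ C, Fin (k C)
  have : Fintype H.ConnectedComponent := Fintype.ofFinite _
  let I' : β → Finset V := fun b => I b.1 b.2
  let D' : β → Finset V := fun b => D b.1 b.2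
  let κ := gluedClass f
  let τ : Finset β := Finset.univ.filter fun b => IsTriangle b.1
  have hτ : ∀ b, b ∈ τ ↔ IsTriangle b.1 := by simp [τ]
  have hI'C : ∀ b : β, ∀ x ∈ I' b, x ∈ b.1.supp := fun b x hx => hDC b.1 b.2 x (hID b.1 b.2 hx)
  have hIdisj : ∀ b b' x, x ∈ I' b → x ∈ I' b' → b = b' := by
    rintro ⟨C, j⟩ ⟨C', j'⟩ x hx hx'
    have h1 := hI'C _ x hx
    have h2 := hI'C _ x hx'
    rw [SimpleGraph.ConnectedComponent.mem_supp_iff] at h1 h2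
    obtain rfl : C = C' := h1.symm.trans h2
    rw [hDdisj C j j' x (hID C j hx) (hID C j' hx')]
  obtain ⟨U, hUτ, ⟨Q, hQinj, hQ⟩, hU⟩ := exists_matching_linkedTo_le_one (κ := κ)
    (fun k => by convert card_gluedClass_le f k) hIdisj (τ := τ) (fun b _ => hI3 b.1 b.2)
    (fun b hb => (hnontri b.1 fun h => hb ((hτ b).2 h)).1 b.2)
  obtain ⟨g, hg1, hg2⟩ := hH.exists_isISR (fun i : Fin q => Finset.univ.image fun a => f ⟨i, a⟩)
    (by
      intro i
      rw [Finset.card_image_of_injective]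
      · simp
      · intro a b hab
        simpa using f.injective hab)
    (by
      intro i j x hx hx'
      simp only [Finset.mem_image, Finset.mem_univ, true_and] at hx hx'
      obtain ⟨a, rfl⟩ := hx
      obtain ⟨b, hb⟩ := hx'
      exact (congrArg Sigma.fst (f.injective hb)).symm) Finset.univ
  have hgκ : ∀ i, κ (g i) = Sum.inl i := by
    intro i
    have := hg1 i (Finset.mem_univ i)
    simp only [Finset.mem_image, Finset.mem_univ, true_and] at this
    obtain ⟨a, ha⟩ := this
    rw [← ha]
    exact gluedClass_apply f _
  -- Only the classes of glued-in copies must be met, hence `F` is the range of `Sum.inl`.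
  obtain ⟨S, hS1, hS2, hS3, hS4⟩ := exists_independent_transversal_hitting (H := H) (κ := κ)
    (F := Set.range Sum.inl) (I := I') (D := D') (B := {b | b ∉ U}) (S₀ := Finset.univ.image g)
    (Q := Q) (fun b => hID b.1 b.2) (fun b => hnbr b.1 b.2)
    (by
      intro x hx y hy
      simp only [Finset.mem_image, Finset.mem_univ, true_and] at hx hy
      obtain ⟨i, rfl⟩ := hx
      obtain ⟨j, rfl⟩ := hy
      exact hg2 i (Finset.mem_univ i) j (Finset.mem_univ j))
    (by
      intro x hx y hy e
      simp only [Finset.coe_image, Finset.coe_univ, Set.image_univ, Set.mem_range] at hx hy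
      obtain ⟨i, rfl⟩ := hx
      obtain ⟨j, rfl⟩ := hy
      rw [hgκ, hgκ] at e
      rw [Sum.inl_injective e])
    (by
      rintro _ ⟨i, rfl⟩
      exact ⟨g i, by simp, hgκ i⟩)
    hQinj (fun b hb => hQ b hb)
  refine ⟨S, hS1, ?_, ?_, ?_⟩
  · intro i
    obtain ⟨x, hx, hxi⟩ := hS3 (Sum.inl i) ⟨i, rfl⟩
    obtain ⟨a, rfl⟩ := exists_of_gluedClass_eq_inl f hxi
    refine ⟨a, hx, fun b hb => ?_⟩
    have := hS2 hb hx (gluedClass_apply_eq f _ _ _)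
    simpa using f.injective this
  · intro C hC
    obtain ⟨-, hk, hB⟩ := hnontri C hC
    have hhit : ∀ j, ∃ s ∈ S, s ∈ D C j := fun j =>
      hS4 ⟨C, j⟩ fun h => hC ((hτ _).1 (hUτ h))
    refine ⟨fun h4 => ?_, hB S hhit⟩
    obtain ⟨s, hs, hsD⟩ := hhit ⟨0, hk h4⟩
    exact ⟨s, hs, hDC C _ s hsD⟩
  · intro C C' hC hCS hC'
    -- Every block outside `U` is hit, so a missed triangle has its block in `U`.
    have hblock : ∀ C₀ : H.ConnectedComponent, IsTriangle C₀ → (∀ s ∈ S, s ∉ C₀.supp) →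
        ∃ b ∈ U, b.1 = C₀ ∧ ∀ x ∈ C₀.supp, x ∈ I' b := by
      intro C₀ h1 h2
      obtain ⟨h3, h4⟩ := htri C₀ h1
      refine ⟨⟨C₀, 0, h3⟩, ?_, rfl, h4 _⟩
      by_contra hb
      obtain ⟨s, hs, hsD⟩ := hS4 _ hb
      exact h2 s hs (hDC C₀ _ s hsD)
    obtain ⟨b, hbU, rfl, hbI⟩ := hblock C hC hCS
    have hlink : ∀ j, ∃ b' ∈ linkedTo κ I' τ U b, b'.1 = C' j := by
      intro j
      obtain ⟨h1, h2, h3, i, x, y, z, hx, hy, hz⟩ := hC' j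
      obtain ⟨b', hb'U, hb', hb'I⟩ := hblock _ h1 h2
      refine ⟨b', Finset.mem_filter.2 ⟨hb'U, ?_, f ⟨i, x⟩, hbI _ hx, f ⟨i, y⟩, hb'I _ hy,
        f ⟨i, z⟩, ?_, ?_, ?_⟩, hb'⟩
      · rintro rfl
        exact h3 hb'.symm
      · exact gluedClass_apply_eq f _ _ _
      · exact gluedClass_apply_eq f _ _ _
      · intro c hc hmem
        have h4 := hI'C c _ hmem
        rw [SimpleGraph.ConnectedComponent.mem_supp_iff] at h4
        rw [h4] at hz
        exact hz ((hτ c).1 hc)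
    obtain ⟨b₁, hb₁, e₁⟩ := hlink true
    obtain ⟨b₂, hb₂, e₂⟩ := hlink false
    rw [← e₁, ← e₂, Finset.card_le_one.1 (hU b hbU) b₁ hb₁ b₂ hb₂]

/-! ### Deleting the transversal -/

theorem AtMostTwoNeighbors.comap {V : Type u} {V' : Type v} {H : SimpleGraph V}
    (hH : AtMostTwoNeighbors H) (ψ : V' ↪ V) : AtMostTwoNeighbors (H.comap ψ) := by
  intro x a b c ha hb hc
  have := hH _ _ _ _ ha hb hc
  simpa using this

theorem mem_supp_of_mem_supp_comap {V : Type u} {V' : Type v} {H : SimpleGraph V} {ψ : V' ↪ V}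
    {C' : (H.comap ψ).ConnectedComponent} {C : H.ConnectedComponent} {x y : V'}
    (hx : x ∈ C'.supp) (hy : y ∈ C'.supp) (hxC : ψ x ∈ C.supp) : ψ y ∈ C.supp :=
  supp_subset_of_closed (A := {y | ψ y ∈ C.supp})
    (fun _ hy _ hz => mem_supp_of_adj (C := C) hy hz) hx hxC hy

/-- A triangle uses up both neighbours of each of its vertices, so it was a component before the
deletion. -/
theorem IsTriangle.exists_supp_eq_image {V : Type u} {V' : Type v} {H : SimpleGraph V}
    (hH : AtMostTwoNeighbors H) {ψ : V' ↪ V} {T : (H.comap ψ).ConnectedComponent}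
    (hT : IsTriangle T) : ∃ C : H.ConnectedComponent, IsTriangle C ∧ C.supp = ψ '' T.supp := by
  obtain ⟨a, b, c, hab, hac, hbc, hT⟩ := isTriangle_iff.1 hT
  have h := hH.supp_eq_of_adj (C := H.connectedComponentMk (ψ a)) (by simp) hab hac hbc
  refine ⟨_, isTriangle_iff.2 ⟨_, _, _, hab, hac, hbc, h⟩, ?_⟩
  rw [h, hT]
  simp [Set.image_insert_eq]

/-- Let `ψ` embed onto the complement of `S`. If each component outside `S` is small, then it is a
triangle or a path. -/
theorem isUnionOfTrianglesAndPaths_comap {V : Type u} {V' : Type v} [Finite V] [Finite V']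
    {H : SimpleGraph V} (hH : AtMostTwoNeighbors H) {S : Finset V} {ψ : V' ↪ V}
    (hψ : ∀ x, ψ x ∉ S)
    (hS : ∀ C : H.ConnectedComponent, ¬ IsTriangle C →
      (4 ≤ C.supp.ncard → ∃ s ∈ S, s ∈ C.supp) ∧
      ∀ x ∈ C.supp, x ∉ S → ∃ B : Finset V, x ∈ B ∧ B.card ≤ 13 ∧
        ∀ y ∈ B, ∀ z ∈ C.supp, z ∉ S → H.Adj y z → z ∈ B) :
    IsUnionOfTrianglesAndPaths (H.comap ψ) 12 := by
  intro C'
  have hH' := hH.comap ψ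
  -- A vertex with at most one neighbour makes `C'` a path. Otherwise no vertex of `C'` lost a
  -- neighbour, so `C'` is a whole component of `H` missed by `S`: a triangle, or one with fewer
  -- than four vertices, which is again a triangle.
  by_cases hdeg : ∃ x ∈ C'.supp, ∀ a b, (H.comap ψ).Adj x a → (H.comap ψ).Adj x b → a = b
  · obtain ⟨x, hx, hdeg⟩ := hdeg
    refine Or.inr ⟨_, ?_, isPathOfLength_of_forall_adj_eq hH' hx hdeg⟩
    have key : ∀ B : Finset V, B.card ≤ 13 → (∀ y ∈ C'.supp, ψ y ∈ B) → C'.supp.ncard - 1 ≤ 12 := by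
      intro B hB hsub
      have := Set.ncard_le_ncard_of_injOn (t := (B : Set V)) ψ hsub ψ.injective.injOn
      rw [Set.ncard_coe_finset] at this
      omega
    set C := H.connectedComponentMk (ψ x) with hCdef
    have hxC : ψ x ∈ C.supp := by simp [hCdef]
    by_cases hC : IsTriangle C
    · have := Fintype.ofFinite V
      classical
      refine key C.supp.toFinset (by rw [hC.card_toFinset]; norm_num) fun y hy => ?_
      rw [Set.mem_toFinset]
      exact mem_supp_of_mem_supp_comap hx hy hxC
    · obtain ⟨B, hxB, hB, hclosed⟩ := (hS C hC).2 (ψ x) hxC (hψ x)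
      refine key B hB fun y hy => ?_
      refine (supp_subset_of_closed (A := {y | ψ y ∈ B ∧ ψ y ∈ C.supp}) ?_ hx ⟨hxB, hxC⟩ hy).1
      rintro y ⟨hyB, hyC⟩ z hz
      have hzC : ψ z ∈ C.supp := mem_supp_of_adj hyC hz
      exact ⟨hclosed _ hyB _ hzC (hψ z) hz, hzC⟩
  · left
    push Not at hdeg
    obtain ⟨x, hx⟩ := C'.nonempty_supp
    set C := H.connectedComponentMk (ψ x) with hCdef
    have hxC : ψ x ∈ C.supp := by simp [hCdef]
    have hsub : C.supp ⊆ ψ '' C'.supp := by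
      refine supp_subset_of_closed ?_ hxC ⟨x, hx, rfl⟩
      rintro _ ⟨y, hy, rfl⟩ z hz
      obtain ⟨a, b, ha, hb, hab⟩ := hdeg y hy
      have hab' : ψ a ≠ ψ b := fun h => hab (ψ.injective h)
      rcases hH _ _ _ _ ha hb hz with h | h | h
      · exact absurd h hab'
      · exact ⟨a, mem_supp_of_adj hy ha, h⟩
      · exact ⟨b, mem_supp_of_adj hy hb, h⟩
    by_cases hC : IsTriangle C
    · obtain ⟨a, b, c, hab, hac, hbc, hCs⟩ := isTriangle_iff.1 hC
      obtain ⟨a', ha', rfl⟩ := hsub (show a ∈ C.supp by simp [hCs])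
      obtain ⟨b', hb', rfl⟩ := hsub (show b ∈ C.supp by simp [hCs])
      obtain ⟨c', hc', rfl⟩ := hsub (show c ∈ C.supp by simp [hCs])
      exact isTriangle_iff.2 ⟨a', b', c', hab, hac, hbc, hH'.supp_eq_of_adj ha' hab hac hbc⟩
    · have hcard : C.supp.ncard < 4 := by
        by_contra! h
        obtain ⟨s, hs, hsC⟩ := (hS C hC).1 h
        obtain ⟨y, -, rfl⟩ := hsub hsC
        exact hψ y hs
      obtain ⟨a, b, ha, hb, hab⟩ := hdeg x hx
      have haC' := mem_supp_of_adj hx ha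
      obtain ⟨c, hc, hcx⟩ : ∃ c, (H.comap ψ).Adj a c ∧ c ≠ x := by
        obtain ⟨c, d, hc, hd, hcd⟩ := hdeg a haC'
        by_cases h : c = x
        · exact ⟨d, hd, fun h' => hcd (h.trans h'.symm)⟩
        · exact ⟨c, hc, h⟩
      have hcb : c = b := by
        by_contra hcb
        have h4 : ({x, a, b, c} : Set V').ncard = 4 := by
          rw [Set.ncard_insert_of_notMem, Set.ncard_insert_of_notMem, Set.ncard_pair (Ne.symm hcb)]
          · simpa using ⟨hab, hc.ne⟩
          · simpa using ⟨ha.ne, hb.ne, hcx.symm⟩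
        have h5 := Set.ncard_le_ncard_of_injOn (s := ({x, a, b, c} : Set V')) (t := C.supp) ψ (by
          have hmem : ∀ y ∈ C'.supp, ψ y ∈ C.supp := fun y hy =>
            mem_supp_of_mem_supp_comap hx hy hxC
          rintro y (rfl | rfl | rfl | rfl)
          exacts [hxC, hmem _ haC', hmem _ (mem_supp_of_adj hx hb),
            hmem _ (mem_supp_of_adj haC' hc)]) ψ.injective.injOn
        omega
      subst hcb
      exact isTriangle_iff.2 ⟨x, a, c, ha, hb, hc, hH'.supp_eq_of_adj hx ha hb hc⟩

/-- A path component of length at least two of an induced subgraph is not part of a triangle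
component of the whole graph. -/
theorem not_isTriangle_of_isPathOfLength {V : Type u} {V' : Type v} {H : SimpleGraph V}
    {ψ : V' ↪ V} {C' : (H.comap ψ).ConnectedComponent} {n : ℕ} (hn : 2 ≤ n)
    (hC' : IsPathOfLength C' n) {C : H.ConnectedComponent} {x : V'} (hx : x ∈ C'.supp)
    (hxC : ψ x ∈ C.supp) : ¬ IsTriangle C := by
  intro hC
  obtain ⟨e⟩ := hC'
  -- Positions 0 and 2 of the path are not adjacent, but all pairs in a triangle are. Remnants of a
  -- hit triangle thus have length at most one, hence the bound `2 ≤ n`.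
  let i₀ : Fin (n + 1) := ⟨0, by omega⟩
  let i₂ : Fin (n + 1) := ⟨2, by omega⟩
  have h0 := mem_supp_of_mem_supp_comap hx (e.symm i₀).2 hxC
  have h2 := mem_supp_of_mem_supp_comap hx (e.symm i₂).2 hxC
  have hne : ψ (e.symm i₀).1 ≠ ψ (e.symm i₂).1 := by
    intro h
    have := e.symm.injective (Subtype.ext (ψ.injective h))
    simp [i₀, i₂] at this
  have hadj : C'.toSimpleGraph.Adj (e.symm i₀) (e.symm i₂) := hC.adj h0 h2 hne
  rw [e.symm.map_adj_iff, SimpleGraph.pathGraph_adj] at hadj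
  simp [i₀, i₂] at hadj

/-- A colouring of the graph induced on the complement of an independent transversal extends by one
new colour. -/
theorem glueComplete_colorable_succ {V : Type u} {V' : Type v} {H : SimpleGraph V} {q n k : ℕ}
    {f : (Σ _ : Fin q, Fin (n + 1)) ↪ V} {S : Finset V} (hS : ∀ x ∈ S, ∀ y ∈ S, ¬ H.Adj x y)
    {a : Fin q → Fin (n + 1)} (ha : ∀ i b, f ⟨i, b⟩ ∈ S ↔ b = a i)
    {ψ : V' ↪ V} (hψ : ∀ x, x ∉ S → ∃ y, ψ y = x) {f' : (Σ _ : Fin q, Fin n) ↪ V'}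
    (hf' : ∀ i b, ψ (f' ⟨i, b⟩) = f ⟨i, (a i).succAbove b⟩)
    (h : (glueComplete (H.comap ψ) f').Colorable k) : (glueComplete H f).Colorable (k + 1) := by
  classical
  obtain ⟨c⟩ := h
  choose g hg using hψ
  refine ⟨SimpleGraph.Coloring.mk
    (fun x => if hx : x ∈ S then Fin.last k else (c (g x hx)).castSucc) ?_⟩
  intro x y hxy
  rw [glueComplete, glue_adj] at hxy
  by_cases hx : x ∈ S <;> by_cases hy : y ∈ S
  · exfalso
    rcases hxy with h | ⟨i, b, b', hbb', rfl, rfl⟩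
    · exact hS x hx y hy h
    · exact hbb' (((ha _ _).1 hx).trans ((ha _ _).1 hy).symm)
  · rw [dif_pos hx, dif_neg hy]
    exact (Fin.castSucc_lt_last _).ne'
  · rw [dif_neg hx, dif_pos hy]
    exact (Fin.castSucc_lt_last _).ne
  · rw [dif_neg hx, dif_neg hy]
    refine fun e => c.valid ?_ (Fin.castSucc_injective _ e)
    rw [glueComplete, glue_adj]
    rcases hxy with h | ⟨i, b, b', hbb', hb, hb'⟩
    · left
      change H.Adj (ψ _) (ψ _)
      rwa [hg, hg]
    · right
      have h1 : b ≠ a i := fun h => hx (hb ▸ (ha _ _).2 h)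
      have h2 : b' ≠ a i := fun h => hy (hb' ▸ (ha _ _).2 h)
      obtain ⟨d, rfl⟩ := Fin.exists_succAbove_eq h1
      obtain ⟨d', rfl⟩ := Fin.exists_succAbove_eq h2
      refine ⟨i, d, d', fun h => hbb' (by rw [h]), ψ.injective ?_, ψ.injective ?_⟩
      · rw [hf', hg, hb]
      · rw [hf', hg, hb']

theorem atMostTwoNeighbors_of_maxDegree_le {V : Type u} [Fintype V] {H : SimpleGraph V}
    [DecidableRel H.Adj] (h : H.maxDegree ≤ 2) : AtMostTwoNeighbors H := by
  intro x a b c ha hb hc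
  by_contra! hne
  have h1 : 2 < (H.neighborFinset x).card :=
    Finset.two_lt_card_iff.2 ⟨a, b, c, by simpa using ha, by simpa using hb, by simpa using hc,
      hne.1, hne.2.1, hne.2.2⟩
  have h2 := H.degree_le_maxDegree x
  rw [SimpleGraph.card_neighborFinset_eq_degree] at h1
  omega

end CyclesPlusK4

/-! ### Conclusion -/

theorem theorem1p1 :
    CyclesPlusK4.TrianglesConjecture.{u} → CyclesPlusK4.CyclesPlusK4Conjecture.{v} := by
  open CyclesPlusK4 in
  intro hconj V _ H _ q f hmax
  have hH := atMostTwoNeighbors_of_maxDegree_le hmax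
  obtain ⟨S, hindep, htrans, hcomp, hlink⟩ := hH.exists_transversal f
  choose a haS hauniq using htrans
  have ha : ∀ i b, f ⟨i, b⟩ ∈ S ↔ b = a i := fun i b => ⟨hauniq i b, fun h => h ▸ haS i⟩
  -- The two conjectures live in unrelated universes, so the complement of `S` is copied to `ULift
  -- (Fin n)`.
  obtain ⟨n, ⟨e⟩⟩ := Finite.exists_equiv_fin {x // x ∉ S}
  let e' : {x // x ∉ S} ≃ ULift.{u} (Fin n) := e.trans Equiv.ulift.symm
  let ψ : ULift.{u} (Fin n) ↪ V := e'.symm.toEmbedding.trans (Function.Embedding.subtype _)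
  have hψS : ∀ x, ψ x ∉ S := fun x => (e'.symm x).2
  have hψ : ∀ x (hx : x ∉ S), ψ (e' ⟨x, hx⟩) = x := fun x hx => by simp [ψ]
  have hout : ∀ (t : Σ _ : Fin q, Fin 3), f ⟨t.1, (a t.1).succAbove t.2⟩ ∉ S := fun t h =>
    Fin.succAbove_ne _ _ ((ha _ _).1 h)
  -- `succAbove` skips the vertex `a i` lying in `S`, which turns each `K₄` into a triangle.
  let f' : (Σ _ : Fin q, Fin 3) ↪ ULift.{u} (Fin n) :=
    ⟨fun t => e' ⟨f ⟨t.1, (a t.1).succAbove t.2⟩, hout t⟩, by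
      rintro ⟨i, b⟩ ⟨j, c⟩ h
      have h1 := f.injective (congrArg Subtype.val (e'.injective h))
      obtain rfl : i = j := congrArg Sigma.fst h1
      simpa using h1⟩
  have hf' : ∀ i b, ψ (f' ⟨i, b⟩) = f ⟨i, (a i).succAbove b⟩ := fun i b => hψ _ _
  refine SimpleGraph.Colorable.chromaticNumber_le
    (glueComplete_colorable_succ hindep ha (fun x hx => ⟨_, hψ x hx⟩) hf'
      (hconj _ (H.comap ψ) q f' (isUnionOfTrianglesAndPaths_comap hH hψS hcomp) ?_))
  intro T T₁ T₂ h₁ h₂ hl₁ hl₂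
  obtain ⟨C, hC, hCs⟩ := hl₁.1.exists_supp_eq_image hH
  have hout' : ∀ (T : (H.comap ψ).ConnectedComponent) (C : H.ConnectedComponent),
      C.supp = ψ '' T.supp → ∀ s ∈ S, s ∉ C.supp := by
    intro T C hC s hs hsC
    rw [hC] at hsC
    obtain ⟨y, -, rfl⟩ := hsC
    exact hψS y hs
  have hex : ∀ T', T' ≠ T → PathLinked f' T T' → ∃ C' : H.ConnectedComponent,
      C'.supp = ψ '' T'.supp ∧ IsTriangle C' ∧ (∀ s ∈ S, s ∉ C'.supp) ∧ C' ≠ C ∧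
        ∃ i a b c, f ⟨i, a⟩ ∈ C.supp ∧ f ⟨i, b⟩ ∈ C'.supp ∧
          ¬ IsTriangle (H.connectedComponentMk (f ⟨i, c⟩)) := by
    rintro T' hne ⟨-, hT', i, x, y, z, -, -, -, hx, hy, m, hm, hz⟩
    obtain ⟨C', hC', hC's⟩ := hT'.exists_supp_eq_image hH
    refine ⟨C', hC's, hC', hout' T' C' hC's, ?_, i, (a i).succAbove x, (a i).succAbove y,
      (a i).succAbove z, ?_, ?_, ?_⟩
    · rintro rfl
      exact hne (SimpleGraph.ConnectedComponent.supp_injective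
        (ψ.injective.image_injective (hC's.symm.trans hCs)))
    · rw [hCs, ← hf']; exact Set.mem_image_of_mem _ hx
    · rw [hC's, ← hf']; exact Set.mem_image_of_mem _ hy
    · rw [← hf']
      exact not_isTriangle_of_isPathOfLength hm hz (x := f' ⟨i, z⟩) (by simp) (by simp)
  obtain ⟨C₁, e₁, p₁⟩ := hex T₁ h₁ hl₁
  obtain ⟨C₂, e₂, p₂⟩ := hex T₂ h₂ hl₂
  have : C₁ = C₂ := hlink C (fun j => bif j then C₁ else C₂) hC (hout' T C hCs) (by
    rintro (_ | _)
    exacts [p₂, p₁])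
  subst this
  exact SimpleGraph.ConnectedComponent.supp_injective
    (ψ.injective.image_injective (e₁.symm.trans e₂))
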